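/- **Optimization problems.** A maximization problem $P=(I,\mathrm{sol},m)$ consists of a set $I$ of instances, a set $\mathrm{sol}(x)$ of feasible solutions for each $x\in I$, and a measure $m(x,y)\ge 0$ for $y\in\mathrm{sol}(x)$; $m^*(x)=\max_{y\in\mathrm{sol}(x)}m(x,y)$. For $\alpha\ge1$, a solution $y\in\mathrm{sol}(x)$ is *$\alpha$-approximate* if $1/\alpha\le |m(x,y)/m^*(x)|\le\alpha$ when $m^*(x)\neq0$, and $m(x,y)=0$ when $m^*(x)=0$. A *randomized approximation scheme* for $P$ is a randomized algorithm that, on input $(x,\varepsilon)\in I\times(0,1)$, outputs a $2^{\varepsilon}$-approximate solution $y\in\mathrm{sol}(x)$ with probability at least $3/4$. **APT-reductions.** $P$ is *APT-reducible* to $Q=(I',\mathrm{sol}',m')$, written $P\le_{\mathrm{APT}}Q$, if there are a randomized oracle algorithm $N$, taking inputs $(x,\varepsilon)\in I\times(0,1)$, and polynomials $p,q$ in two variables such that, for every randomized approximation scheme $M$ for $Q$ (not necessarily of polynomial running time) used as oracle: (i) $N$ with oracle $M$ is a randomized approximation scheme for $P$; (ii) every oracle call made by $N$ on input $(x,\varepsilon)$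 is of the form $(w,\delta)\in I'\times(0,1)$ with $1/\delta\le p(|x|,1/\varepsilon)$, and is answered by an outcome of $M$ on $(w,\delta)$; (iii) $N$ on input $(x,\varepsilon)$ halts on every computation path within $q(|x|,1/\varepsilon)$ steps. Here $N$ and the polynomials $p,q$ do not depend on $M$. Algorithms run on a random access machine with coin flips and oracle calls, in which a real number (a weight, a value of a constraint, or $\varepsilon$) occupies one cell, real numbers can be copied, compared, added, subtracted, multiplied and divided, integers can be copied, compared, incremented and decremented, and each operation costs one step; $|x|$ is the length of the representation of $x$, a real number counting as one symbol. **The problems.** A constraint of arity $k$ is a function $f:\{0,1\}^k\to\mathbb{R}^{\ge0}$, represented by the list of its values in lexicographic order; $OR=(0,1,1,1)$ and $Implies=(1,1,0,1)$. For a set $\mathcal F$ of constraints, an instance of MAX-PROD-CSP$(\mathcal F)$ is a finite set $H$ of pairs $\langle h,(x_{i_1},\dots,x_{i_k})\rangle$ on Boolean variables $x_1,\dots,x_n$, where $h\in\mathcal F$ has arity $k$ and $i_1,\dots,i_k\in\{1,\dots,n\}$; the solutions are the assignments $\sigma:\{x_1,\dots,x_n\}\to\{0,1\}$, and the measure of $\sigma$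 is $\prod_{\langle h,(x_{i_1},\dots,x_{i_k})\rangle\in H}h(\sigma(x_{i_1}),\dots,\sigma(x_{i_k}))$. MAX-PROD-CSP$^*(\mathcal F)$ is MAX-PROD-CSP$(\mathcal F\cup\mathcal U)$, where $\mathcal U$ is the set of all constraints of arity $1$. An instance of MAX-PROD-IS is a finite undirected graph $G=(V,E)$ with vertex weights $w_v\in\mathbb{R}^{\ge0}$ ($v\in V$); the solutions are the independent sets $A\subseteq V$ of $G$, with measure $\prod_{v\in A}w_v$. MAX-PROD-BIS is MAX-PROD-IS restricted to bipartite graphs. **Lemma.** 1. $\text{MAX-PROD-IS}\le_{\mathrm{APT}}\text{MAX-PROD-CSP}^*(OR)$. 2. $\text{MAX-PROD-BIS}\le_{\mathrm{APT}}\text{MAX-PROD-CSP}^*(Implies)$. -/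

import Mathlib

open scoped NNReal ENNReal

noncomputable section

/-! ### Words over natural numbers and real numbers -/

/-- The strings handled by the machines: a string of natural numbers (structural data such as
bits and indices) and a string of real numbers (weights), a real number being one symbol. -/
@[ext] structure Word where
  nats : List ℕ
  reals : List ℝ

/-- Length of a word; natural numbers are counted in unary, a real number counts as one. -/
def Word.size (d : Word) : ℕ := (d.nats.map (· + 1)).sum + d.reals.length

/-! ### Maximization problems, approximate solutions, randomized approximation schemes -/

/-- A maximization problem `(I, sol, m)` with the representation of its instances and solutions
as words. `Sol x` is the type of feasible solutions of the instance `x`. -/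
structure MaxProblem where
  Inst : Type
  Sol : Inst → Type
  measure : (x : Inst) → Sol x → ℝ≥0
  encInst : Inst → Word
  encSol : (x : Inst) → Sol x → Word
  encInst_injective : Function.Injective encInst
  encSol_injective : ∀ x, Function.Injective (encSol x)

/-- `y` is an `α`-approximate solution of the instance `x`. -/
def MaxProblem.IsApprox (P : MaxProblem) (α : ℝ) (x : P.Inst) (y : P.Sol x) : Prop :=
  ∃ mstar : ℝ≥0, IsGreatest (Set.range (P.measure x)) mstar ∧
    (mstar = 0 → P.measure x y = 0) ∧
    (mstar ≠ 0 → 1 / α ≤ |(P.measure x y : ℝ) / (mstar : ℝ)| ∧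
      |(P.measure x y : ℝ) / (mstar : ℝ)| ≤ α)

/-- The input-output behaviour of a randomized algorithm that takes a word and an error
tolerance and outputs a random word. -/
abbrev RandomizedMap : Type := Word → ℝ → PMF Word

/-- `M` is (the input-output behaviour of) a randomized approximation scheme for `P`: on `(x, ε)`
it outputs, with probability at least `3/4`, a `2 ^ ε`-approximate solution. The remaining outputs
are arbitrary words. -/
def MaxProblem.IsRAS (P : MaxProblem) (M : RandomizedMap) : Prop :=
  ∀ (x : P.Inst) (ε : ℝ), 0 < ε → ε < 1 →
    (3 / 4 : ℝ≥0∞) ≤ (M (P.encInst x) ε).toOuterMeasure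
      {d | ∃ y : P.Sol x, P.encSol x y = d ∧ P.IsApprox ((2 : ℝ) ^ ε) x y}

/-! ### Randomized oracle machines over the reals

A random access machine with registers for natural numbers (successor and predecessor only) and
registers for real numbers (field operations and comparison, no rounding), a memory consisting of
numbered extendible arrays, fair coin flips and oracle calls. Every elementary operation costs one
step. Array `0` holds the input, array `1` the query, array `2` the oracle's answer and array `3`
the output. -/

/-- Elementary operations. `i j k` are numbers of registers, `a` is the number of an array. -/
inductive Op
  /-- `n_i := 0` -/
  | zero (i : ℕ)
  /-- `n_i := n_i + 1` -/
  | succ (i : ℕ)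
  /-- `n_i := n_i - 1`, truncated at `0` -/
  | pred (i : ℕ)
  /-- `n_i := n_j` -/
  | copy (i j : ℕ)
  /-- `n_i :=` length of the natural number part of array `a` -/
  | len (i a : ℕ)
  /-- `n_i := a[n_j]` (`0` outside the array) -/
  | load (i a j : ℕ)
  /-- `a[n_j] := n_i` (no effect outside the array) -/
  | store (a j i : ℕ)
  /-- append `n_i` to the array `a` -/
  | push (a i : ℕ)
  /-- `r_i := 0` -/
  | rzero (i : ℕ)
  /-- `r_i := 1` -/
  | rone (i : ℕ)
  /-- `r_i := r_j` -/
  | rcopy (i j : ℕ)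
  /-- `r_i := r_j + r_k` -/
  | radd (i j k : ℕ)
  /-- `r_i := r_j - r_k` -/
  | rsub (i j k : ℕ)
  /-- `r_i := r_j * r_k` -/
  | rmul (i j k : ℕ)
  /-- `r_i := r_j / r_k` (`0` if `r_k = 0`) -/
  | rdiv (i j k : ℕ)
  /-- `n_i :=` length of the real part of array `a` -/
  | rlen (i a : ℕ)
  /-- `r_i := a[n_j]` in the real part (`0` outside the array) -/
  | rload (i a j : ℕ)
  /-- `a[n_j] := r_i` in the real part (no effect outside the array) -/
  | rstore (a j i : ℕ)
  /-- append `r_i` to the real part of array `a` -/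
  | rpush (a i : ℕ)
  /-- empty the array `a` -/
  | clear (a : ℕ)
  /-- `n_i :=` a fair random bit -/
  | flip (i : ℕ)
  /-- call the oracle on the word in array `1` with tolerance `r_i`; the answer goes to array `2` -/
  | query (i : ℕ)

/-- Tests on registers. -/
inductive Test
  /-- `n_i < n_j` -/
  | lt (i j : ℕ)
  /-- `n_i = n_j` -/
  | eq (i j : ℕ)
  /-- `r_i < r_j` -/
  | rlt (i j : ℕ)
  /-- `r_i = r_j` -/
  | req (i j : ℕ)

/-- Programs. -/
inductive Prog
  | skip
  | op (o : Op)
  | seq (p q : Prog)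
  | ite (t : Test) (p q : Prog)
  | while (t : Test) (p : Prog)

/-- Contents of the registers and of the memory. -/
structure Store where
  reg : ℕ → ℕ
  rreg : ℕ → ℝ
  mem : ℕ → Word

namespace Store

def setReg (s : Store) (i v : ℕ) : Store := { s with reg := Function.update s.reg i v }

def setRReg (s : Store) (i : ℕ) (v : ℝ) : Store := { s with rreg := Function.update s.rreg i v }

def setMem (s : Store) (a : ℕ) (d : Word) : Store := { s with mem := Function.update s.mem a d }

def setNats (s : Store) (a : ℕ) (l : List ℕ) : Store := s.setMem a ⟨l, (s.mem a).reals⟩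

def setReals (s : Store) (a : ℕ) (l : List ℝ) : Store := s.setMem a ⟨(s.mem a).nats, l⟩

end Store

/-- Effect of an elementary operation, with oracle `M`. -/
def Op.exec (M : RandomizedMap) (s : Store) : Op → PMF Store
  | .zero i => PMF.pure (s.setReg i 0)
  | .succ i => PMF.pure (s.setReg i (s.reg i + 1))
  | .pred i => PMF.pure (s.setReg i (s.reg i - 1))
  | .copy i j => PMF.pure (s.setReg i (s.reg j))
  | .len i a => PMF.pure (s.setReg i (s.mem a).nats.length)
  | .load i a j => PMF.pure (s.setReg i ((s.mem a).nats.getD (s.reg j) 0))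
  | .store a j i => PMF.pure (s.setNats a ((s.mem a).nats.set (s.reg j) (s.reg i)))
  | .push a i => PMF.pure (s.setNats a ((s.mem a).nats ++ [s.reg i]))
  | .rzero i => PMF.pure (s.setRReg i 0)
  | .rone i => PMF.pure (s.setRReg i 1)
  | .rcopy i j => PMF.pure (s.setRReg i (s.rreg j))
  | .radd i j k => PMF.pure (s.setRReg i (s.rreg j + s.rreg k))
  | .rsub i j k => PMF.pure (s.setRReg i (s.rreg j - s.rreg k))
  | .rmul i j k => PMF.pure (s.setRReg i (s.rreg j * s.rreg k))
  | .rdiv i j k => PMF.pure (s.setRReg i (s.rreg j / s.rreg k))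
  | .rlen i a => PMF.pure (s.setReg i (s.mem a).reals.length)
  | .rload i a j => PMF.pure (s.setRReg i ((s.mem a).reals.getD (s.reg j) 0))
  | .rstore a j i => PMF.pure (s.setReals a ((s.mem a).reals.set (s.reg j) (s.rreg i)))
  | .rpush a i => PMF.pure (s.setReals a ((s.mem a).reals ++ [s.rreg i]))
  | .clear a => PMF.pure (s.setMem a ⟨[], []⟩)
  | .flip i => (PMF.uniformOfFintype (Fin 2)).map fun b => s.setReg i b
  | .query i => (M (s.mem 1) (s.rreg i)).map fun d => s.setMem 2 d

def Test.holds (s : Store) : Test → Prop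
  | .lt i j => s.reg i < s.reg j
  | .eq i j => s.reg i = s.reg j
  | .rlt i j => s.rreg i < s.rreg j
  | .req i j => s.rreg i = s.rreg j

/-- A configuration: the stack of programs that remain to be executed, and the store. -/
structure Config where
  todo : List Prog
  store : Store

/-- The machine has halted. -/
def Config.Halted (c : Config) : Prop := c.todo = []

open Classical in
/-- One step of computation with oracle `M`; halted configurations do not change. -/
def Config.step (M : RandomizedMap) (c : Config) : PMF Config :=
  match c.todo with
  | [] => PMF.pure c
  | .skip :: K => PMF.pure ⟨K, c.store⟩
  | .op o :: K => (o.exec M c.store).map fun s => ⟨K, s⟩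
  | .seq p q :: K => PMF.pure ⟨p :: q :: K, c.store⟩
  | .ite t p q :: K => PMF.pure ⟨(if t.holds c.store then p else q) :: K, c.store⟩
  | .while t p :: K =>
      PMF.pure ⟨if t.holds c.store then p :: .while t p :: K else K, c.store⟩

/-- Distribution of the configuration after `n` steps. -/
def Config.run (M : RandomizedMap) : ℕ → Config → PMF Config
  | 0, c => PMF.pure c
  | n + 1, c => (c.step M).bind (Config.run M n)

/-- Initial configuration of the program `N` on input `(d, ε)`: the word `d` is in array `0`, the
number `ε` in the real register `0`, and everything else is zero or empty. -/
def Prog.start (N : Prog) (d : Word) (ε : ℝ) : Config where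
  todo := [N]
  store :=
    { reg := fun _ => 0
      rreg := Function.update (fun _ => 0) 0 ε
      mem := Function.update (fun _ => ⟨[], []⟩) 0 d }

/-- The value `p(|d|, 1/ε)` of a bivariate polynomial. -/
def polyBound (p : MvPolynomial (Fin 2) ℝ) (d : Word) (ε : ℝ) : ℝ :=
  MvPolynomial.eval ![(d.size : ℝ), 1 / ε] p

/-- Distribution of the output (the content of array `3`) of `N` with oracle `M` after
`⌊q(|d|, 1/ε)⌋` steps. -/
def Prog.outcome (N : Prog) (q : MvPolynomial (Fin 2) ℝ) (M : RandomizedMap) : RandomizedMap :=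
  fun d ε => ((N.start d ε).run M ⌊polyBound q d ε⌋₊).map fun c => c.store.mem 3

/-- `P` is APT-reducible to `Q`. -/
def APTReduces (P Q : MaxProblem) : Prop :=
  ∃ (N : Prog) (p q : MvPolynomial (Fin 2) ℝ), ∀ M : RandomizedMap, Q.IsRAS M →
    -- `N` with oracle `M` is a randomized approximation scheme for `P`
    P.IsRAS (N.outcome q M) ∧
    -- every oracle call is of the form `(w, δ)` with `w` an instance of `Q`, `0 < δ < 1` and
    -- `1/δ ≤ p(|x|, 1/ε)`
    (∀ (x : P.Inst) (ε : ℝ), 0 < ε → ε < 1 →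
      ∀ (t : ℕ), ∀ c ∈ ((N.start (P.encInst x) ε).run M t).support,
        ∀ (i : ℕ) (K : List Prog), c.todo = .op (.query i) :: K →
          (∃ w : Q.Inst, Q.encInst w = c.store.mem 1) ∧
          0 < c.store.rreg i ∧ c.store.rreg i < 1 ∧
          1 / c.store.rreg i ≤ polyBound p (P.encInst x) ε) ∧
    -- `N` halts on every computation path within `q(|x|, 1/ε)` steps
    (∀ (x : P.Inst) (ε : ℝ), 0 < ε → ε < 1 → 0 ≤ polyBound q (P.encInst x) ε ∧
      ∀ c ∈ ((N.start (P.encInst x) ε).run M ⌊polyBound q (P.encInst x) ε⌋₊).support,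
        c.Halted)

/-! ### Constraint satisfaction problems with multiplicative measure -/

/-- A nonnegative-real-weighted constraint. -/
structure Constraint where
  arity : ℕ
  val : (Fin arity → Bool) → ℝ≥0

/-- The output values of a function on `{0,1}^k` in lexicographic order. -/
def valueTable : (k : ℕ) → ((Fin k → Bool) → ℝ≥0) → List ℝ
  | 0, f => [(f Fin.elim0 : ℝ)]
  | k + 1, f => valueTable k (fun v => f (Fin.cons false v)) ++
      valueTable k (fun v => f (Fin.cons true v))

/-- The constraint `OR = (0,1,1,1)`. -/
def constraintOR : Constraint where
  arity := 2
  val := fun v => if v 0 = true ∨ v 1 = true then 1 else 0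

/-- The constraint `Implies = (1,1,0,1)`. -/
def constraintImplies : Constraint where
  arity := 2
  val := fun v => if v 0 = true → v 1 = true then 1 else 0

/-- The set of all unary constraints. -/
def unaryConstraints : Set Constraint := {f | f.arity = 1}

/-- A constraint applied to a series of variables among `n` variables. -/
structure ConstraintApp (n : ℕ) where
  con : Constraint
  vars : Fin con.arity → Fin n

/-- Instance of the constraint satisfaction problem over `F`: a finite set, listed without
repetitions, of applications of constraints from `F` to `numVars` Boolean variables. -/
structure CSPInst (F : Set Constraint) where
  numVars : ℕ
  apps : List (ConstraintApp numVars)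
  nodup : apps.Nodup
  mem : ∀ a ∈ apps, a.con ∈ F

/-- The arity followed by the indices of the variables. -/
def ConstraintApp.natCode {n : ℕ} (a : ConstraintApp n) : List ℕ :=
  a.con.arity :: List.ofFn fun j => (a.vars j : ℕ)

def ConstraintApp.realCode {n : ℕ} (a : ConstraintApp n) : List ℝ :=
  valueTable a.con.arity a.con.val

def CSPInst.enc {F : Set Constraint} (x : CSPInst F) : Word where
  nats := x.numVars :: x.apps.flatMap ConstraintApp.natCode
  reals := x.apps.flatMap ConstraintApp.realCode

def CSPInst.measure {F : Set Constraint} (x : CSPInst F) (σ : Fin x.numVars → Bool) : ℝ≥0 :=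
  (x.apps.map fun a => a.con.val fun j => σ (a.vars j)).prod

/-- The word listing `n` bits. -/
def bitWord {n : ℕ} (σ : Fin n → Bool) : Word where
  nats := List.ofFn fun i => (σ i).toNat
  reals := []

theorem bitWord_injective (n : ℕ) : Function.Injective (bitWord (n := n)) := by
  intro σ τ h
  have h1 := List.ofFn_injective (congrArg Word.nats h)
  funext i
  have h2 := congrFun h1 i
  cases hσ : σ i <;> cases hτ : τ i <;> simp_all

theorem valueTable_length (k : ℕ) (f : (Fin k → Bool) → ℝ≥0) :
    (valueTable k f).length = 2 ^ k := by
  induction k with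
  | zero => simp [valueTable]
  | succ k ih => simp [valueTable, ih, pow_succ, mul_two]

theorem valueTable_injective (k : ℕ) : Function.Injective (valueTable k) := by
  induction k with
  | zero =>
    intro f g h
    funext v
    have hv : v = Fin.elim0 := Subsingleton.elim _ _
    subst hv
    simpa [valueTable] using h
  | succ k ih =>
    intro f g h
    obtain ⟨h0, h1⟩ := List.append_inj h (by simp [valueTable_length])
    funext v
    rw [← Fin.cons_self_tail v]
    cases v 0
    · exact congrFun (ih h0) (Fin.tail v)
    · exact congrFun (ih h1) (Fin.tail v)

theorem appCode_injective {n : ℕ} (l l' : List (ConstraintApp n))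
    (h : l.flatMap ConstraintApp.natCode = l'.flatMap ConstraintApp.natCode)
    (h' : l.flatMap ConstraintApp.realCode = l'.flatMap ConstraintApp.realCode) : l = l' := by
  induction l generalizing l' with
  | nil =>
    cases l' with
    | nil => rfl
    | cons a t => simp [ConstraintApp.natCode] at h
  | cons a t ih =>
    cases l' with
    | nil => simp [ConstraintApp.natCode] at h
    | cons b t' =>
      obtain ⟨⟨k, f⟩, u⟩ := a
      obtain ⟨⟨k', f'⟩, u'⟩ := b
      simp only [List.flatMap_cons, ConstraintApp.natCode, ConstraintApp.realCode,
        List.cons_append, List.cons.injEq] at h h'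
      obtain ⟨rfl, h⟩ := h
      obtain ⟨h1, h2⟩ := List.append_inj h (by simp)
      obtain ⟨h3, h4⟩ := List.append_inj h' (by simp [valueTable_length])
      have hf := valueTable_injective _ h3
      subst hf
      have hu : u = u' := funext fun j => Fin.ext (congrFun (List.ofFn_injective h1) j)
      subst hu
      rw [ih t' h2 h4]

theorem CSPInst.enc_injective (F : Set Constraint) :
    Function.Injective (CSPInst.enc (F := F)) := by
  rintro ⟨n, l, _, _⟩ ⟨n', l', _, _⟩ h
  simp only [CSPInst.enc, Word.mk.injEq, List.cons.injEq] at h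
  obtain ⟨⟨rfl, h1⟩, h2⟩ := h
  obtain rfl := appCode_injective l l' h1 h2
  rfl

/-- MAX-PROD-CSP(`F`). -/
def maxProdCSP (F : Set Constraint) : MaxProblem where
  Inst := CSPInst F
  Sol := fun x => Fin x.numVars → Bool
  measure := fun x σ => x.measure σ
  encInst := fun x => x.enc
  encSol := fun _ σ => bitWord σ
  encInst_injective := CSPInst.enc_injective F
  encSol_injective := fun _ => bitWord_injective _

/-- MAX-PROD-CSP*(`F`): all unary constraints are free. -/
def maxProdCSPStar (F : Set Constraint) : MaxProblem := maxProdCSP (F ∪ unaryConstraints)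

/-! ### Maximum product independent set -/

/-- An undirected graph with nonnegative real vertex weights. -/
structure WeightedGraph where
  numVertices : ℕ
  graph : SimpleGraph (Fin numVertices)
  weight : Fin numVertices → ℝ≥0

open Classical in
/-- The number of vertices and the adjacency matrix, row by row; the list of weights. -/
def WeightedGraph.enc (x : WeightedGraph) : Word where
  nats := x.numVertices :: List.ofFn fun p : Fin (x.numVertices * x.numVertices) =>
    if x.graph.Adj p.divNat p.modNat then 1 else 0
  reals := List.ofFn fun v => (x.weight v : ℝ)

theorem WeightedGraph.enc_injective : Function.Injective WeightedGraph.enc := by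
  classical
  rintro ⟨n, G, w⟩ ⟨n', G', w'⟩ h
  simp only [WeightedGraph.enc, Word.mk.injEq, List.cons.injEq] at h
  obtain ⟨⟨rfl, h1⟩, h2⟩ := h
  have hw : w = w' := funext fun v => NNReal.coe_injective (congrFun (List.ofFn_injective h2) v)
  have hG : G = G' := by
    ext u v
    have h3 := congrFun (List.ofFn_injective h1) (finProdFinEquiv (u, v))
    have h4 := finProdFinEquiv.symm_apply_apply (u, v)
    rw [finProdFinEquiv_symm_apply, Prod.mk.injEq] at h4
    rw [h4.1, h4.2] at h3
    by_cases hu : G.Adj u v <;> by_cases hv : G'.Adj u v <;> simp_all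
  rw [hw, hG]

/-- The feasible solutions: independent sets. -/
abbrev WeightedGraph.IndepSet (x : WeightedGraph) : Type :=
  {A : Finset (Fin x.numVertices) // x.graph.IsIndepSet (A : Set (Fin x.numVertices))}

/-- The product of the weights of the chosen vertices. -/
def WeightedGraph.measure (x : WeightedGraph) (A : x.IndepSet) : ℝ≥0 :=
  ∏ v ∈ A.1, x.weight v

/-- An independent set is represented by its characteristic vector. -/
def WeightedGraph.encSol (x : WeightedGraph) (A : x.IndepSet) : Word :=
  bitWord fun v => decide (v ∈ A.1)

theorem WeightedGraph.encSol_injective (x : WeightedGraph) : Function.Injective x.encSol := by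
  intro A B h
  have h1 := bitWord_injective _ h
  ext v
  simpa using congrFun h1 v

/-- MAX-PROD-IS. -/
def maxProdIS : MaxProblem where
  Inst := WeightedGraph
  Sol := fun x => x.IndepSet
  measure := fun x A => x.measure A
  encInst := fun x => x.enc
  encSol := fun x A => x.encSol A
  encInst_injective := WeightedGraph.enc_injective
  encSol_injective := WeightedGraph.encSol_injective

/-- MAX-PROD-BIS: the input graphs are bipartite (no bipartition is given with the input). -/
def maxProdBIS : MaxProblem where
  Inst := {x : WeightedGraph // x.graph.IsBipartite}
  Sol := fun x => x.1.IndepSet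
  measure := fun x A => x.1.measure A
  encInst := fun x => x.1.enc
  encSol := fun x A => x.1.encSol A
  encInst_injective := fun _ _ h => Subtype.ext (WeightedGraph.enc_injective h)
  encSol_injective := fun x => x.1.encSol_injective

end

/-! Both reductions ask the oracle one question, with the given tolerance, and turn an approximate
answer into a solution with the same ratio. The common part is `aptReduces_of_templates`: each
vertex receives four Boolean variables, constraints are copied from fixed templates for every vertex
and every ordered adjacent pair, and one decoder reads off the set.

For `OR`, a vertex is selected when its variable is false. The assignments of nonzero measure are
then the independent sets, and the measure is the product of the selected weights. The empty set has
measure 1, so an approximate answer has nonzero measure.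

For `Implies`, no bipartition is supplied and none is computed. Variables 0 and 1 encode an
independent set of the bipartite double cover, whose measure is a product of two measures of the
graph once a proper 2-colouring is known. Variables 2 and 3 make the oracle find that colouring. The
implications make them constant on each component of the double cover; they differ at every vertex
exactly when they give a proper colouring. Tags `4 ^ 2 ^ u`, obtained by repeated squaring at unit
cost, reward this. If variables 2 and 3 agreed somewhere, recolouring by either bipartition would
multiply the measure by powers of 4 with opposite exponents (`measure_recolour`). The exponent is
nonzero because distinct sets of vertices have distinct sums of powers of 2, so one recolouring
gains a factor of at least 4, more than the ratio allows (`ne_of_nearly_optimal`). With the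
colouring fixed, the measure is m(A) m(B) times a constant (`measure_combine`). Replacing A while
keeping B shows that A inherits the ratio. -/

noncomputable section

/-! ### Deterministic computations -/

/-- Effect of an operation that neither flips a coin nor calls the oracle. -/
def Op.eff (s : Store) : Op → Store
  | .zero i => s.setReg i 0
  | .succ i => s.setReg i (s.reg i + 1)
  | .pred i => s.setReg i (s.reg i - 1)
  | .copy i j => s.setReg i (s.reg j)
  | .len i a => s.setReg i (s.mem a).nats.length
  | .load i a j => s.setReg i ((s.mem a).nats.getD (s.reg j) 0)
  | .store a j i => s.setNats a ((s.mem a).nats.set (s.reg j) (s.reg i))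
  | .push a i => s.setNats a ((s.mem a).nats ++ [s.reg i])
  | .rzero i => s.setRReg i 0
  | .rone i => s.setRReg i 1
  | .rcopy i j => s.setRReg i (s.rreg j)
  | .radd i j k => s.setRReg i (s.rreg j + s.rreg k)
  | .rsub i j k => s.setRReg i (s.rreg j - s.rreg k)
  | .rmul i j k => s.setRReg i (s.rreg j * s.rreg k)
  | .rdiv i j k => s.setRReg i (s.rreg j / s.rreg k)
  | .rlen i a => s.setReg i (s.mem a).reals.length
  | .rload i a j => s.setRReg i ((s.mem a).reals.getD (s.reg j) 0)
  | .rstore a j i => s.setReals a ((s.mem a).reals.set (s.reg j) (s.rreg i))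
  | .rpush a i => s.setReals a ((s.mem a).reals ++ [s.rreg i])
  | .clear a => s.setMem a ⟨[], []⟩
  | .flip _ => s
  | .query _ => s

/-- The operation neither flips a coin nor calls the oracle. -/
def Op.Det : Op → Prop
  | .flip _ => False
  | .query _ => False
  | _ => True

theorem Op.Det.exec_eq {o : Op} (h : o.Det) (M : RandomizedMap) (s : Store) :
    o.exec M s = PMF.pure (o.eff s) := by
  cases o <;> first | rfl | exact h.elim

/-- The next step of the machine is an oracle call. -/
def Config.AtQuery (c : Config) : Prop := ∃ i K, c.todo = .op (.query i) :: K

/-- `Path n c c'`: whatever the oracle, the machine moves from `c` to `c'` in `n` steps, without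
coin flips and oracle calls. -/
inductive Config.Path : ℕ → Config → Config → Prop
  | refl (c : Config) : Path 0 c c
  | cons {n : ℕ} {c c' c'' : Config} (h : ∀ M, c.step M = PMF.pure c') (hq : ¬ c.AtQuery)
      (hp : Path n c' c'') : Path (n + 1) c c''

namespace Config

theorem Path.trans {m n : ℕ} {a b c : Config} (h : Path m a b) (h' : Path n b c) :
    Path (m + n) a c := by
  induction h with
  | refl => simpa using h'
  | cons h hq _ ih =>
    rw [Nat.add_right_comm]
    exact .cons h hq (ih h')

theorem Path.run_add {n : ℕ} {c c' : Config} (h : Path n c c') (M : RandomizedMap) (m : ℕ) :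
    run M (n + m) c = run M m c' := by
  induction h with
  | refl => simp
  | cons h _ _ ih => rw [Nat.add_right_comm, run, h, PMF.pure_bind, ih]

theorem Path.not_atQuery {n : ℕ} {c c' : Config} (h : Path n c c') (M : RandomizedMap) {t : ℕ}
    (ht : t < n) {e : Config} (he : e ∈ (run M t c).support) : ¬ e.AtQuery := by
  induction h generalizing t with
  | refl => omega
  | cons h hq _ ih =>
    cases t with
    | zero =>
      simp only [run, PMF.support_pure, Set.mem_singleton_iff] at he
      exact he ▸ hq
    | succ t =>
      rw [run, h, PMF.pure_bind] at he
      exact ih (by omega) he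

theorem run_halted (M : RandomizedMap) (n : ℕ) (s : Store) :
    run M n ⟨[], s⟩ = PMF.pure ⟨[], s⟩ := by
  induction n with
  | zero => rfl
  | succ n ih => rw [run, step, PMF.pure_bind, ih]

end Config

/-- Started in the store `s`, the program `p` halts within `T` steps in a store satisfying `Q`,
without coin flips and oracle calls. -/
def Prog.Meets (p : Prog) (s : Store) (T : ℕ) (Q : Store → Prop) : Prop :=
  ∃ s', Q s' ∧ ∃ t ≤ T, ∀ K, Config.Path t ⟨p :: K, s⟩ ⟨K, s'⟩

/-! ### Total-correctness rules with running times for deterministic programs -/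

namespace Prog

theorem Meets.mono {p : Prog} {s : Store} {T T' : ℕ} {Q Q' : Store → Prop} (h : p.Meets s T Q)
    (hT : T ≤ T') (hQ : ∀ s, Q s → Q' s) : p.Meets s T' Q' := by
  obtain ⟨s', hs, t, ht, hp⟩ := h
  exact ⟨s', hQ _ hs, t, ht.trans hT, hp⟩

theorem meets_skip {s : Store} {Q : Store → Prop} (h : Q s) : skip.Meets s 1 Q :=
  ⟨s, h, 1, le_rfl, fun K => .cons (fun _ => rfl) (by rintro ⟨_, _, h⟩; cases h) (.refl _)⟩

theorem meets_op {o : Op} (ho : o.Det) {s : Store} {Q : Store → Prop} (h : Q (o.eff s)) :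
    (op o).Meets s 1 Q := by
  refine ⟨_, h, 1, le_rfl, fun K => .cons (fun M => ?_) ?_ (.refl _)⟩
  · change (o.exec M s).map _ = _
    rw [ho.exec_eq, PMF.pure_map]
  · rintro ⟨_, _, h⟩
    simp only [List.cons.injEq, op.injEq] at h
    rw [h.1] at ho
    exact ho

theorem Meets.seq {p q : Prog} {s : Store} {T T' : ℕ} {R Q : Store → Prop} (h : p.Meets s T R)
    (h' : ∀ s', R s' → q.Meets s' T' Q) : (seq p q).Meets s (T + T' + 1) Q := by
  obtain ⟨s₁, h₁, t₁, ht₁, hp₁⟩ := h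
  obtain ⟨s₂, h₂, t₂, ht₂, hp₂⟩ := h' _ h₁
  exact ⟨s₂, h₂, t₁ + t₂ + 1, by omega, fun K => .cons (c' := ⟨p :: q :: K, s⟩) (fun _ => rfl)
    (by rintro ⟨_, _, h⟩; cases h) ((hp₁ _).trans (hp₂ _))⟩

theorem meets_ite {t : Test} {p q : Prog} {s : Store} {T : ℕ} {Q : Store → Prop}
    (hp : t.holds s → p.Meets s T Q) (hq : ¬ t.holds s → q.Meets s T Q) :
    (ite t p q).Meets s (T + 1) Q := by
  by_cases ht : t.holds s
  · obtain ⟨s', h, n, hn, hp⟩ := hp ht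
    refine ⟨s', h, n + 1, by omega, fun K => .cons (c' := ⟨p :: K, s⟩) (fun _ => ?_)
      (by rintro ⟨_, _, h⟩; cases h) (hp K)⟩
    simp [Config.step, ht]
  · obtain ⟨s', h, n, hn, hp⟩ := hq ht
    refine ⟨s', h, n + 1, by omega, fun K => .cons (c' := ⟨q :: K, s⟩) (fun _ => ?_)
      (by rintro ⟨_, _, h⟩; cases h) (hp K)⟩
    simp [Config.step, ht]

/-- The invariant is indexed by the number of completed rounds, which fixes the iteration count.
Each round pays one step for its test besides the body, and the final summand 1 is the failing test.
-/
theorem meets_while {t : Test} {p : Prog} {T N : ℕ} {I : ℕ → Store → Prop}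
    (hI : ∀ k < N, ∀ s, I k s → t.holds s ∧ p.Meets s T (I (k + 1)))
    (hN : ∀ s, I N s → ¬ t.holds s) {s : Store} (hs : I 0 s) :
    (Prog.while t p).Meets s (N * (T + 1) + 1) (I N) := by
  suffices h : ∀ m k, k + m = N → ∀ s, I k s →
      (Prog.while t p).Meets s (m * (T + 1) + 1) (I N) from h N 0 (by omega) s hs
  intro m
  induction m with
  | zero =>
    rintro k rfl s hs
    refine ⟨s, hs, 1, by omega, fun K => .cons (fun _ => ?_) (by rintro ⟨_, _, h⟩; cases h)
      (.refl _)⟩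
    simp [Config.step, hN s hs]
  | succ m ih =>
    intro k hk s hs
    obtain ⟨ht, s₁, h₁, t₁, ht₁, hp₁⟩ := hI k (by omega) s hs
    obtain ⟨s₂, h₂, t₂, ht₂, hp₂⟩ := ih (k + 1) (by omega) s₁ h₁
    refine ⟨s₂, h₂, t₁ + t₂ + 1, by rw [Nat.succ_mul]; omega, fun K =>
      .cons (c' := ⟨p :: Prog.while t p :: K, s⟩) (fun _ => ?_)
        (by rintro ⟨_, _, h⟩; cases h) ((hp₁ _).trans (hp₂ _))⟩
    simp [Config.step, ht]

/-- Straight-line programs. -/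
def block : List Op → Prog
  | [] => skip
  | o :: l => seq (op o) (block l)

theorem meets_block {l : List Op} (hl : ∀ o ∈ l, o.Det) {s : Store} {Q : Store → Prop}
    (h : Q (l.foldl Op.eff s)) : (block l).Meets s (2 * l.length + 1) Q := by
  induction l generalizing s with
  | nil => exact meets_skip h
  | cons o l ih =>
    refine ((meets_op (Q := (· = o.eff s)) (hl o (by simp)) rfl).seq (T' := 2 * l.length + 1)
      (Q := Q) ?_).mono (by simp; omega) fun _ h => h
    rintro _ rfl
    exact ih (fun o ho => hl o (by simp [ho])) h

end Prog

/-! ### Programs with a single oracle call -/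

/-- Prepare a query, call the oracle with the tolerance in real register `0`, process the answer. -/
def Prog.singleQuery (p q : Prog) : Prog := .seq p (.seq (.op (.query 0)) q)

namespace Prog

variable {p q : Prog} {d : Word} {ε : ℝ} {T T' : ℕ} {w : Word} {out : Word → Word}

/-- Since an oracle's answer may be any word, the postcondition of `p` asks `q` to halt correctly
for every answer `a`, within a time independent of `a`. -/
theorem Meets.exists_path_query
    (hp : p.Meets (p.start d ε).store T fun s => s.mem 1 = w ∧ s.rreg 0 = ε ∧
      ∀ a, q.Meets (s.setMem 2 a) T' fun s' => s'.mem 3 = out a) :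
    ∃ (s : Store) (t : ℕ), t ≤ T + 2 ∧ s.mem 1 = w ∧ s.rreg 0 = ε ∧
      Config.Path t ((singleQuery p q).start d ε) ⟨[.op (.query 0), q], s⟩ ∧
      ∀ a, ∃ (s' : Store) (t' : ℕ), t' ≤ T' ∧ s'.mem 3 = out a ∧
        Config.Path t' ⟨[q], s.setMem 2 a⟩ ⟨[], s'⟩ := by
  obtain ⟨s, ⟨hw, hε, hq⟩, t, ht, hp⟩ := hp
  refine ⟨s, t + 1 + 1, by omega, hw, hε, ?_, fun a => ?_⟩
  · refine .cons (c' := ⟨[p, .seq (.op (.query 0)) q], (p.start d ε).store⟩) (fun _ => rfl)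
      (by rintro ⟨_, _, h⟩; cases h) ((hp _).trans ?_)
    exact .cons (fun _ => rfl) (by rintro ⟨_, _, h⟩; cases h) (.refl _)
  · obtain ⟨s', h, t', ht', hp'⟩ := hq a
    exact ⟨s', t', ht', h, hp' _⟩

variable {M : RandomizedMap}

/-- The processing time may depend on the answer, but halted configurations are stationary. After
the uniform bound, the law of the final configuration is therefore the image of the oracle's law. -/
theorem run_singleQuery (hp : p.Meets (p.start d ε).store T fun s => s.mem 1 = w ∧ s.rreg 0 = ε ∧
      ∀ a, q.Meets (s.setMem 2 a) T' fun s' => s'.mem 3 = out a) {n : ℕ} (hn : T + T' + 3 ≤ n) :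
    ∃ f : Word → Store, (∀ a, (f a).mem 3 = out a) ∧
      ((singleQuery p q).start d ε).run M n = (M w ε).map fun a => ⟨[], f a⟩ := by
  obtain ⟨s, t, ht, hw, hε, hpath, hq⟩ := hp.exists_path_query
  choose f t' ht' hf hpath' using hq
  refine ⟨f, hf, ?_⟩
  obtain ⟨m, rfl⟩ : ∃ m, n = t + (m + 1) := ⟨n - t - 1, by omega⟩
  rw [hpath.run_add, Config.run]
  simp only [Config.step, Op.exec, hw, hε, PMF.map_comp]
  rw [PMF.bind_map, ← PMF.bind_pure_comp]
  congr 1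
  funext a
  obtain ⟨m', rfl⟩ : ∃ m', m = t' a + m' := ⟨m - t' a, by have := ht' a; omega⟩
  simp only [Function.comp_apply]
  rw [(hpath' a).run_add, Config.run_halted]

/-- The run is a query-free path, one query, then a query-free path to a halted configuration; so
only one moment can present a query. -/
theorem atQuery_singleQuery
    (hp : p.Meets (p.start d ε).store T fun s => s.mem 1 = w ∧ s.rreg 0 = ε ∧
      ∀ a, q.Meets (s.setMem 2 a) T' fun s' => s'.mem 3 = out a) {n : ℕ} {c : Config}
    (hc : c ∈ (((singleQuery p q).start d ε).run M n).support) {i : ℕ} {K : List Prog}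
    (hK : c.todo = .op (.query i) :: K) : c.store.mem 1 = w ∧ c.store.rreg i = ε := by
  obtain ⟨s, t, ht, hw, hε, hpath, hq⟩ := hp.exists_path_query
  rcases lt_or_ge n t with hn | hn
  · exact absurd ⟨i, K, hK⟩ (hpath.not_atQuery M hn hc)
  obtain ⟨m, rfl⟩ := Nat.exists_eq_add_of_le hn
  rw [hpath.run_add] at hc
  cases m with
  | zero =>
    simp only [Config.run, PMF.support_pure, Set.mem_singleton_iff] at hc
    subst hc
    simp only [List.cons.injEq, op.injEq, Op.query.injEq] at hK
    exact ⟨hw, hK.1 ▸ hε⟩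
  | succ m =>
    simp only [Config.run, Config.step, Op.exec, PMF.map_comp, PMF.bind_map] at hc
    obtain ⟨a, -, hc⟩ := (PMF.mem_support_bind_iff _ _ _).1 hc
    simp only [Function.comp_apply] at hc
    obtain ⟨s', t', -, -, hpath'⟩ := hq a
    rcases lt_or_ge m t' with hm | hm
    · exact absurd ⟨i, K, hK⟩ (hpath'.not_atQuery M hm hc)
    obtain ⟨m', rfl⟩ := Nat.exists_eq_add_of_le hm
    rw [hpath'.run_add, Config.run_halted] at hc
    simp only [PMF.support_pure, Set.mem_singleton_iff] at hc
    subst hc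
    cases hK

end Prog

/-- A program with a single oracle call, made with the given tolerance, that runs in quadratic time
and translates approximate solutions into approximate solutions, is an APT-reduction. -/
theorem aptReduces_of_singleQuery {P Q : MaxProblem} (p q : Prog) (b : ℕ)
    (f : P.Inst → Q.Inst) (out : P.Inst → Word → Word)
    (hmeets : ∀ x ε, ∃ T T' : ℕ, T + T' + 3 ≤ b * ((P.encInst x).size + 1) ^ 2 ∧
      p.Meets (p.start (P.encInst x) ε).store T fun s =>
        s.mem 1 = Q.encInst (f x) ∧ s.rreg 0 = ε ∧
          ∀ a, q.Meets (s.setMem 2 a) T' fun s' => s'.mem 3 = out x a)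
    (hout : ∀ x (ε : ℝ), 0 < ε → ε < 1 → ∀ y, Q.IsApprox ((2 : ℝ) ^ ε) (f x) y →
      ∃ z, P.encSol x z = out x (Q.encSol (f x) y) ∧ P.IsApprox ((2 : ℝ) ^ ε) x z) :
    APTReduces P Q := by
  let B : MvPolynomial (Fin 2) ℝ := MvPolynomial.C (b : ℝ) * (MvPolynomial.X 0 + 1) ^ 2
  have hB : ∀ d ε, polyBound B d ε = ((b * (d.size + 1) ^ 2 : ℕ) : ℝ) := by
    intro d ε
    simp [B, polyBound]
  -- The tolerance is passed on unchanged, so the bound on its inverse is the polynomial 1/ε itself.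
  refine ⟨.singleQuery p q, MvPolynomial.X 1, B, fun M hM => ⟨?_, ?_, ?_⟩⟩
  · intro x ε h0 h1
    obtain ⟨T, T', hT, hm⟩ := hmeets x ε
    obtain ⟨g, hg, hrun⟩ := Prog.run_singleQuery (M := M) hm hT
    simp only [Prog.outcome, hB, Nat.floor_natCast]
    rw [hrun, PMF.map_comp, PMF.toOuterMeasure_map_apply]
    -- Every good answer of the oracle yields a good output, so the probability 3/4 carries over
    -- without amplification.
    refine (hM (f x) ε h0 h1).trans (MeasureTheory.OuterMeasure.mono _ ?_)
    rintro _ ⟨y, rfl, hy⟩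
    obtain ⟨z, hz, hz'⟩ := hout x ε h0 h1 y hy
    exact ⟨z, by simp [hg, hz], hz'⟩
  · intro x ε h0 h1 t c hc i K hK
    obtain ⟨T, T', -, hm⟩ := hmeets x ε
    obtain ⟨hw, hε⟩ := Prog.atQuery_singleQuery hm hc hK
    exact ⟨⟨f x, hw.symm⟩, by rwa [hε], by rwa [hε], by simp [hε, polyBound]⟩
  · intro x ε h0 h1
    obtain ⟨T, T', hT, hm⟩ := hmeets x ε
    obtain ⟨g, hg, hrun⟩ := Prog.run_singleQuery (M := M) hm hT
    refine ⟨by rw [hB]; positivity, fun c hc => ?_⟩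
    rw [hB, Nat.floor_natCast, hrun, PMF.support_map] at hc
    obtain ⟨a, -, rfl⟩ := hc
    rfl

/-! ### A program that translates graphs into instances of constraint satisfaction -/

/-- Natural numbers that the program can write while it treats the vertices `u` and `v`: a constant,
or one of the variables belonging to `u` or to `v`; the variables of vertex `u` begin at `4 * u`. -/
inductive NatSource
  | const (k : ℕ)
  | fst (k : ℕ)
  | snd (k : ℕ)

def NatSource.value (u v : ℕ) : NatSource → ℕ
  | const k => k
  | fst k => 4 * u + k
  | snd k => 4 * v + k

def NatSource.ops : NatSource → List Op
  | const k => .copy 16 8 :: List.replicate k (.succ 16) ++ [.push 1 16]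
  | fst k => .copy 16 2 :: List.replicate k (.succ 16) ++ [.push 1 16]
  | snd k => .copy 16 4 :: List.replicate k (.succ 16) ++ [.push 1 16]

/-- Real numbers that the program can write: besides the constants, the weight of the present vertex
and a number `tag` attached to it. -/
inductive RealSource
  | zero
  | one
  | weight
  | tag

def RealSource.value (c w : ℝ) : RealSource → ℝ
  | zero => 0
  | one => 1
  | weight => w
  | tag => c

def RealSource.ops : RealSource → List Op
  | zero => [.rpush 1 1]
  | one => [.rpush 1 2]
  | weight => [.rpush 1 4]
  | tag => [.rpush 1 3]

/-- A piece of the encoding of an instance. -/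
structure Template where
  nats : List NatSource
  reals : List RealSource

namespace Template

def natWord (V : Template) (u v : ℕ) : List ℕ := V.nats.map (NatSource.value u v)

def realWord (V : Template) (c w : ℝ) : List ℝ := V.reals.map (RealSource.value c w)

def ops (V : Template) : List Op := V.nats.flatMap NatSource.ops ++ V.reals.flatMap RealSource.ops

theorem ops_det (V : Template) : ∀ o ∈ V.ops, o.Det := by
  intro o ho
  simp only [ops, List.mem_append, List.mem_flatMap] at ho
  rcases ho with ⟨a, -, ho⟩ | ⟨a, -, ho⟩
  · cases a <;> simp only [NatSource.ops, List.cons_append, List.mem_cons, List.mem_append,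
      List.mem_replicate, List.not_mem_nil, or_false] at ho <;>
      rcases ho with rfl | ⟨-, rfl⟩ | rfl <;> trivial
  · cases a <;> simp only [RealSource.ops, List.mem_singleton] at ho <;> subst ho <;> trivial

end Template

/-- The contents of the store while the query is prepared: `n` vertices, input `d`, tolerance `ε`,
present vertices `u` and `v`, position `p` in the adjacency matrix, tag `c` and weight `w`, query
`(l, r)`. -/
structure Translating (n : ℕ) (d : Word) (ε : ℝ) (u v p : ℕ) (c w : ℝ) (l : List ℕ) (r : List ℝ)
    (s : Store) : Prop where
  reg0 : s.reg 0 = n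
  reg1 : s.reg 1 = u
  reg2 : s.reg 2 = 4 * u
  reg3 : s.reg 3 = v
  reg4 : s.reg 4 = 4 * v
  reg5 : s.reg 5 = p
  reg7 : s.reg 7 = 1
  reg8 : s.reg 8 = 0
  rreg0 : s.rreg 0 = ε
  rreg1 : s.rreg 1 = 0
  rreg2 : s.rreg 2 = 1
  rreg3 : s.rreg 3 = c
  rreg4 : s.rreg 4 = w
  mem0 : s.mem 0 = d
  mem1 : s.mem 1 = ⟨l, r⟩
  mem3 : s.mem 3 = ⟨[], []⟩

theorem foldl_succ (k i : ℕ) (s : Store) :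
    (List.replicate k (Op.succ i)).foldl Op.eff s = s.setReg i (s.reg i + k) := by
  induction k generalizing s with
  | zero => simp [Store.setReg]
  | succ k ih =>
    simp [List.replicate_succ, ih, Op.eff, Store.setReg, Nat.add_assoc, Nat.add_comm 1]

namespace Translating

variable {n : ℕ} {d : Word} {ε : ℝ} {u v p : ℕ} {c w : ℝ} {l : List ℕ} {r : List ℝ} {s : Store}

theorem natSource (h : Translating n d ε u v p c w l r s) (a : NatSource) :
    Translating n d ε u v p c w (l ++ [a.value u v]) r (a.ops.foldl Op.eff s) := by
  obtain ⟨h0, h1, h2, h3, h4, h5, h7, h8, r0, r1, r2, r3, r4, m0, m1, m3⟩ := h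
  cases a <;> constructor <;>
    simp [NatSource.ops, foldl_succ, Op.eff, Store.setReg, Store.setNats, Store.setMem,
      NatSource.value, *]

theorem realSource (h : Translating n d ε u v p c w l r s) (a : RealSource) :
    Translating n d ε u v p c w l (r ++ [a.value c w]) (a.ops.foldl Op.eff s) := by
  obtain ⟨h0, h1, h2, h3, h4, h5, h7, h8, r0, r1, r2, r3, r4, m0, m1, m3⟩ := h
  cases a <;> constructor <;>
    simp [RealSource.ops, Op.eff, Store.setReals, Store.setMem, RealSource.value, *]

theorem template (h : Translating n d ε u v p c w l r s) (V : Template) :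
    Translating n d ε u v p c w (l ++ V.natWord u v) (r ++ V.realWord c w)
      (V.ops.foldl Op.eff s) := by
  have hn : ∀ (L : List NatSource) (l : List ℕ) (s : Store), Translating n d ε u v p c w l r s →
      Translating n d ε u v p c w (l ++ L.map (NatSource.value u v)) r
        ((L.flatMap NatSource.ops).foldl Op.eff s) := by
    intro L
    induction L with
    | nil => intro l s h; simpa using h
    | cons a L ih =>
      intro l s h
      simpa using ih _ _ (h.natSource a)
  have hr : ∀ (L : List RealSource) (l : List ℕ) (r : List ℝ) (s : Store),
      Translating n d ε u v p c w l r s →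
      Translating n d ε u v p c w l (r ++ L.map (RealSource.value c w))
        ((L.flatMap RealSource.ops).foldl Op.eff s) := by
    intro L
    induction L with
    | nil => intro l r s h; simpa using h
    | cons a L ih =>
      intro l r s h
      simpa using ih _ _ _ (h.realSource a)
  rw [Template.ops, List.foldl_append]
  exact hr _ _ _ _ (hn _ _ _ h)

end Translating

/-- Write the template `V` for every vertex, with tag `4 ^ 2 ^ u` for the vertex `u`. -/
def vertexLoop (V : Template) : Prog :=
  .while (.lt 1 0) (.seq (.block [.rload 4 0 1]) (.seq (.block V.ops)
    (.block [.rmul 3 3 3, .succ 1, .succ 2, .succ 2, .succ 2, .succ 2])))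

/-- Write the template `E` for every neighbour `v` of the present vertex `u`. -/
def neighbourLoop (E : Template) : Prog :=
  .while (.lt 3 0) (.seq (.block [.load 6 0 5]) (.seq (.ite (.eq 6 7) (.block E.ops) (.block []))
    (.block [.succ 5, .succ 3, .succ 4, .succ 4, .succ 4, .succ 4])))

/-- Write the template `E` for every pair of adjacent vertices. -/
def edgeLoop (E : Template) : Prog :=
  .while (.lt 1 0) (.seq (.block [.zero 3, .zero 4]) (.seq (neighbourLoop E)
    (.block [.succ 1, .succ 2, .succ 2, .succ 2, .succ 2])))

/-- Integers cannot be multiplied, so register 2 follows 4u by increments. The head of the query is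
a placeholder 0, overwritten by 4n when the vertex loop has brought register 2 there. Real register
3 starts at 4, the tag of vertex 0. -/
def translateGraph (V E : Template) : Prog :=
  .seq (.block [.rone 2, .load 0 0 8, .succ 7, .succ 5, .push 1 8, .rone 3, .radd 3 3 3,
    .rmul 3 3 3]) (.seq (vertexLoop V) (.seq
  (.block [.store 1 8 2, .rzero 3, .rzero 4, .zero 1, .zero 2]) (.seq (edgeLoop E)
  (.block [.zero 1, .zero 2]))))

/-- The first three variables of each vertex determine whether it belongs to the independent set. -/
def decodeLoop : Prog :=
  .while (.lt 1 0) (.seq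
    (.block [.load 9 2 2, .succ 2, .load 10 2 2, .succ 2, .load 11 2 2, .succ 2, .succ 2, .zero 16])
    (.seq (.ite (.eq 11 7) (.ite (.eq 9 7) (.block [.succ 16]) (.block []))
        (.ite (.eq 10 8) (.block [.succ 16]) (.block [])))
      (.block [.push 3 16, .succ 1])))

/-- The natural numbers written for the neighbours `v < k` of `u`. -/
def neighbourNats (E : Template) (n : ℕ) (d : Word) (u k : ℕ) : List ℕ :=
  (List.range k).flatMap fun v => if d.nats.getD (n * u + v + 1) 0 = 1 then E.natWord u v else []

/-- The real numbers written for the neighbours `v < k` of `u`. -/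
def neighbourReals (E : Template) (n : ℕ) (d : Word) (u k : ℕ) : List ℝ :=
  (List.range k).flatMap fun v => if d.nats.getD (n * u + v + 1) 0 = 1 then E.realWord 0 0 else []

/-- The query written by `translateGraph V E`. -/
def translation (V E : Template) (n : ℕ) (d : Word) : Word where
  nats := 4 * n :: ((List.range n).flatMap fun u => V.natWord u 0) ++
    (List.range n).flatMap fun u => neighbourNats E n d u n
  reals := ((List.range n).flatMap fun u => V.realWord (4 ^ 2 ^ u) (d.reals.getD u 0)) ++
    (List.range n).flatMap fun u => neighbourReals E n d u n

def decodeBit (a : List ℕ) (u : ℕ) : ℕ :=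
  if a.getD (4 * u + 2) 0 = 1 then (if a.getD (4 * u) 0 = 1 then 1 else 0)
  else if a.getD (4 * u + 1) 0 = 0 then 1 else 0

/-- The output of `decodeLoop` on the answer `a`. -/
def decoding (n : ℕ) (a : Word) : Word := ⟨(List.range n).map (decodeBit a.nats), []⟩

/-! ### Correctness and running time of the loops -/

section

variable {V E : Template} {n : ℕ} {d : Word} {ε : ℝ} {s : Store}

theorem vertexLoop_meets {w : ℝ} {l : List ℕ}
    (h : Translating n d ε 0 0 1 4 w l [] s) :
    (vertexLoop V).Meets s (n * (2 * V.ops.length + 20) + 1) fun s => ∃ c w,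
      Translating n d ε n 0 1 c w (l ++ (List.range n).flatMap fun u => V.natWord u 0)
        ((List.range n).flatMap fun u => V.realWord (4 ^ 2 ^ u) (d.reals.getD u 0)) s := by
  refine (Prog.meets_while (T := 2 * V.ops.length + 19) (N := n) (I := fun k s => ∃ w,
    Translating n d ε k 0 1 (4 ^ 2 ^ k) w (l ++ (List.range k).flatMap fun u => V.natWord u 0)
      ((List.range k).flatMap fun u => V.realWord (4 ^ 2 ^ u) (d.reals.getD u 0)) s)
    ?_ ?_ ?_).mono le_rfl fun s h => ⟨_, h⟩
  · rintro k hk s ⟨w, h⟩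
    refine ⟨by simpa [Test.holds, h.reg0, h.reg1] using hk, ?_⟩
    refine ((Prog.meets_block (Q := Translating n d ε k 0 1 (4 ^ 2 ^ k) (d.reals.getD k 0)
      (l ++ (List.range k).flatMap fun u => V.natWord u 0)
      ((List.range k).flatMap fun u => V.realWord (4 ^ 2 ^ u) (d.reals.getD u 0)))
      (by simp [Op.Det]) ?_).seq fun s h =>
      (Prog.meets_block V.ops_det (h.template V)).seq (T' := 13) fun s h =>
        Prog.meets_block (by simp [Op.Det]) ⟨d.reals.getD k 0, ?_⟩).mono ?_ fun _ h => h
    · obtain ⟨h0, h1, h2, h3, h4, h5, h7, h8, r0, r1, r2, r3, r4, m0, m1, m3⟩ := h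
      constructor <;> simp [Op.eff, Store.setRReg, *]
    · simp; omega
    · obtain ⟨h0, h1, h2, h3, h4, h5, h7, h8, r0, r1, r2, r3, r4, m0, m1, m3⟩ := h
      constructor <;> simp [Op.eff, Store.setRReg, Store.setReg, List.range_succ, *] <;> ring
  · rintro s ⟨w, h⟩
    simp [Test.holds, h.reg0, h.reg1]
  · exact ⟨w, by simpa using h⟩

/-- The matrix position is advanced in every inner round and never reset between rows, which
replaces the multiplication in `n * u + k + 1`. The summand 1 skips the vertex count at the head of
the input. -/
theorem neighbourLoop_meets {u : ℕ} {l : List ℕ} {r : List ℝ}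
    (h : Translating n d ε u 0 (n * u + 1) 0 0 l r s) :
    (neighbourLoop E).Meets s (n * (2 * E.ops.length + 21) + 1)
      (Translating n d ε u n (n * u + n + 1) 0 0 (l ++ neighbourNats E n d u n)
        (r ++ neighbourReals E n d u n)) := by
  refine Prog.meets_while (T := 2 * E.ops.length + 20) (N := n) (I := fun k =>
    Translating n d ε u k (n * u + k + 1) 0 0 (l ++ neighbourNats E n d u k)
      (r ++ neighbourReals E n d u k)) ?_ ?_ ?_
  · rintro k hk s h
    refine ⟨by simpa [Test.holds, h.reg0, h.reg3] using hk, ?_⟩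
    refine ((Prog.meets_block (Q := fun s => Translating n d ε u k (n * u + k + 1) 0 0
      (l ++ neighbourNats E n d u k) (r ++ neighbourReals E n d u k) s ∧
      s.reg 6 = d.nats.getD (n * u + k + 1) 0)
      (by simp [Op.Det]) ?_).seq fun s h =>
      (Prog.meets_ite (T := 2 * E.ops.length + 1) (Q := Translating n d ε u k (n * u + k + 1) 0 0
      (l ++ neighbourNats E n d u (k + 1)) (r ++ neighbourReals E n d u (k + 1))) ?_ ?_).seq
        (T' := 13) fun s h =>
        Prog.meets_block (by simp [Op.Det]) ?_).mono ?_ fun _ h => h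
    · obtain ⟨h0, h1, h2, h3, h4, h5, h7, h8, r0, r1, r2, r3, r4, m0, m1, m3⟩ := h
      refine ⟨?_, by simp [Op.eff, Store.setReg, *]⟩
      constructor <;> simp [Op.eff, Store.setReg, *]
    · intro ht
      have ht : d.nats.getD (n * u + k + 1) 0 = 1 := by
        simpa [Test.holds, h.2, h.1.reg7] using ht
      refine Prog.meets_block E.ops_det ?_
      have := h.1.template E
      rwa [List.append_assoc, List.append_assoc, show neighbourNats E n d u k ++ E.natWord u k =
        neighbourNats E n d u (k + 1) by
          simp [neighbourNats, List.range_succ, ht, -List.getD_eq_getElem?_getD],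
        show neighbourReals E n d u k ++ E.realWord 0 0 =
        neighbourReals E n d u (k + 1) by
          simp [neighbourReals, List.range_succ, ht, -List.getD_eq_getElem?_getD]] at this
    · intro ht
      have ht : ¬ d.nats.getD (n * u + k + 1) 0 = 1 := by
        simpa [Test.holds, h.2, h.1.reg7] using ht
      refine (Prog.meets_block (by simp) ?_).mono (by simp) fun _ h => h
      have := h.1
      rwa [show neighbourNats E n d u k = neighbourNats E n d u (k + 1) by
          simp [neighbourNats, List.range_succ, ht, -List.getD_eq_getElem?_getD],
        show neighbourReals E n d u k = neighbourReals E n d u (k + 1) by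
          simp [neighbourReals, List.range_succ, ht, -List.getD_eq_getElem?_getD]] at this
    · obtain ⟨h0, h1, h2, h3, h4, h5, h7, h8, r0, r1, r2, r3, r4, m0, m1, m3⟩ := h
      constructor <;> simp [Op.eff, Store.setReg, *] <;> ring
    · simp; omega
  · rintro s h
    simp [Test.holds, h.reg0, h.reg3]
  · simpa [neighbourNats, neighbourReals] using h

theorem edgeLoop_meets {l : List ℕ} {r : List ℝ}
    (h : Translating n d ε 0 0 1 0 0 l r s) :
    (edgeLoop E).Meets s (n * (n * (2 * E.ops.length + 21) + 20) + 1) fun s => ∃ v,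
      Translating n d ε n v (n * n + 1) 0 0
        (l ++ (List.range n).flatMap fun u => neighbourNats E n d u n)
        (r ++ (List.range n).flatMap fun u => neighbourReals E n d u n) s := by
  refine Prog.meets_while (T := n * (2 * E.ops.length + 21) + 19) (N := n) (I := fun k s => ∃ v,
    Translating n d ε k v (n * k + 1) 0 0
        (l ++ (List.range k).flatMap fun u => neighbourNats E n d u n)
        (r ++ (List.range k).flatMap fun u => neighbourReals E n d u n) s) ?_ ?_ ?_
  · rintro k hk s ⟨v, h⟩
    refine ⟨by simpa [Test.holds, h.reg0, h.reg1] using hk, ?_⟩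
    refine ((Prog.meets_block (Q := Translating n d ε k 0 (n * k + 1) 0 0
        (l ++ (List.range k).flatMap fun u => neighbourNats E n d u n)
        (r ++ (List.range k).flatMap fun u => neighbourReals E n d u n))
      (by simp [Op.Det]) ?_).seq fun s h => (neighbourLoop_meets h).seq (T' := 11) fun s h =>
        Prog.meets_block (by simp [Op.Det]) ⟨n, ?_⟩).mono ?_ fun _ h => h
    · obtain ⟨h0, h1, h2, h3, h4, h5, h7, h8, r0, r1, r2, r3, r4, m0, m1, m3⟩ := h
      constructor <;> simp [Op.eff, Store.setReg, *]
    · simp; omega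
    · obtain ⟨h0, h1, h2, h3, h4, h5, h7, h8, r0, r1, r2, r3, r4, m0, m1, m3⟩ := h
      constructor <;> simp [Op.eff, Store.setReg, List.range_succ, *] <;> ring
  · rintro s ⟨v, h⟩
    simp [Test.holds, h.reg0, h.reg1]
  · exact ⟨0, by simpa using h⟩

theorem translateGraph_meets (hd : d.nats.getD 0 0 = n) :
    (translateGraph V E).Meets ((translateGraph V E).start d ε).store
      (n * (2 * V.ops.length + 20) + n * (n * (2 * E.ops.length + 21) + 20) + 41) fun s =>
        s.reg 0 = n ∧ s.reg 1 = 0 ∧ s.reg 2 = 0 ∧ s.reg 7 = 1 ∧ s.reg 8 = 0 ∧ s.rreg 0 = ε ∧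
          s.mem 1 = translation V E n d ∧ s.mem 3 = ⟨[], []⟩ := by
  refine ((Prog.meets_block (Q := Translating n d ε 0 0 1 4 0 [0] []) (by simp [Op.Det]) ?_).seq
    (T' := n * (2 * V.ops.length + 20) + n * (n * (2 * E.ops.length + 21) + 20) + 23)
    fun s h => ((vertexLoop_meets h).seq
    (T' := n * (n * (2 * E.ops.length + 21) + 20) + 21) ?_).mono (by omega) fun _ h => h).mono
    (by simp; omega) fun _ h => h
  · rw [List.getD_eq_getElem?_getD] at hd
    constructor <;>
      simp [Op.eff, Store.setReg, Store.setRReg, Store.setNats, Store.setMem, Prog.start, hd] <;>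
      norm_num
  · rintro s ⟨c, w, h⟩
    refine ((Prog.meets_block (Q := Translating n d ε 0 0 1 0 0 (4 * n ::
      (List.range n).flatMap fun u => V.natWord u 0)
      ((List.range n).flatMap fun u => V.realWord (4 ^ 2 ^ u) (d.reals.getD u 0)))
      (by simp [Op.Det]) ?_).seq fun s h =>
      (edgeLoop_meets h).seq (T' := 5) ?_).mono (by simp; omega) fun _ h => h
    · obtain ⟨h0, h1, h2, h3, h4, h5, h7, h8, r0, r1, r2, r3, r4, m0, m1, m3⟩ := h
      constructor <;>
        simp [Op.eff, Store.setReg, Store.setRReg, Store.setNats, Store.setMem, *]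
    · rintro s ⟨v, h⟩
      refine Prog.meets_block (by simp [Op.Det]) ?_
      obtain ⟨h0, h1, h2, h3, h4, h5, h7, h8, r0, r1, r2, r3, r4, m0, m1, m3⟩ := h
      simp [Op.eff, Store.setReg, translation, *]

theorem decodeLoop_meets (h0 : s.reg 0 = n) (h1 : s.reg 1 = 0) (h2 : s.reg 2 = 0)
    (h7 : s.reg 7 = 1) (h8 : s.reg 8 = 0) (hm : s.mem 3 = ⟨[], []⟩) :
    decodeLoop.Meets s (n * 30 + 1) fun s' => s'.mem 3 = decoding n (s.mem 2) := by
  let J : Word → ℕ → Store → Prop := fun a k s => s.reg 0 = n ∧ s.reg 1 = k ∧ s.reg 2 = 4 * k ∧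
    s.reg 7 = 1 ∧ s.reg 8 = 0 ∧ s.mem 2 = a ∧ s.mem 3 = decoding k a
  refine (Prog.meets_while (T := 29) (N := n) (I := J (s.mem 2)) ?_ ?_ ?_).mono le_rfl
    fun s h => h.2.2.2.2.2.2
  · generalize s.mem 2 = a
    rintro k hk s ⟨h0, h1, h2, h7, h8, ha, hm⟩
    refine ⟨by simpa [Test.holds, h0, h1] using hk, ?_⟩
    refine ((Prog.meets_block (Q := fun s => s.reg 0 = n ∧ s.reg 1 = k ∧ s.reg 2 = 4 * (k + 1) ∧
      s.reg 7 = 1 ∧ s.reg 8 = 0 ∧ s.mem 2 = a ∧ s.mem 3 = decoding k a ∧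
      s.reg 9 = a.nats.getD (4 * k) 0 ∧ s.reg 10 = a.nats.getD (4 * k + 1) 0 ∧
      s.reg 11 = a.nats.getD (4 * k + 2) 0 ∧ s.reg 16 = 0) (by simp [Op.Det]) ?_).seq (T' := 11)
      fun s h => ((Prog.meets_ite (T := 4) (Q := fun s => s.reg 0 = n ∧ s.reg 1 = k ∧
        s.reg 2 = 4 * (k + 1) ∧ s.reg 7 = 1 ∧ s.reg 8 = 0 ∧ s.mem 2 = a ∧
        s.mem 3 = decoding k a ∧ s.reg 16 = decodeBit a.nats k) ?_ ?_).seq (T' := 5)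
        fun s h => Prog.meets_block (by simp [Op.Det]) ?_)).mono (by simp) fun _ h => h
    · simp [Op.eff, Store.setReg, *]
      ring
    · obtain ⟨h0, h1, h2, h7, h8, ha, hm, h9, h10, h11, h16⟩ := h
      intro ht
      replace ht : a.nats.getD (4 * k + 2) 0 = 1 := by simpa [Test.holds, h11, h7] using ht
      refine Prog.meets_ite (T := 3) (fun ht' => ?_) fun ht' => ?_
      · replace ht' : a.nats.getD (4 * k) 0 = 1 := by simpa [Test.holds, h9, h7] using ht'
        refine Prog.meets_block (by simp [Op.Det]) ?_
        simp [Op.eff, Store.setReg, decodeBit, *, -List.getD_eq_getElem?_getD]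
      · replace ht' : ¬ a.nats.getD (4 * k) 0 = 1 := by simpa [Test.holds, h9, h7] using ht'
        refine (Prog.meets_block (by simp) ?_).mono (by simp) fun _ h => h
        simp [decodeBit, *, -List.getD_eq_getElem?_getD]
    · obtain ⟨h0, h1, h2, h7, h8, ha, hm, h9, h10, h11, h16⟩ := h
      intro ht
      replace ht : ¬ a.nats.getD (4 * k + 2) 0 = 1 := by simpa [Test.holds, h11, h7] using ht
      refine Prog.meets_ite (T := 3) (fun ht' => ?_) fun ht' => ?_
      · replace ht' : a.nats.getD (4 * k + 1) 0 = 0 := by simpa [Test.holds, h10, h8] using ht'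
        refine Prog.meets_block (by simp [Op.Det]) ?_
        simp [Op.eff, Store.setReg, decodeBit, *, -List.getD_eq_getElem?_getD]
      · replace ht' : ¬ a.nats.getD (4 * k + 1) 0 = 0 := by simpa [Test.holds, h10, h8] using ht'
        refine (Prog.meets_block (by simp) ?_).mono (by simp) fun _ h => h
        simp [decodeBit, *, -List.getD_eq_getElem?_getD]
    · obtain ⟨h0, h1, h2, h7, h8, ha, hm, h16⟩ := h
      simp [J, Op.eff, Store.setReg, Store.setNats, Store.setMem, decoding, List.range_succ, *]
  · rintro s ⟨h0, h1, -⟩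
    simp [Test.holds, h0, h1]
  · simp [J, decoding, *]

end

/-- An APT-reduction from a problem on weighted graphs, given by templates for the constraints
belonging to the vertices and to the edges. -/
theorem aptReduces_of_templates {P Q : MaxProblem} (g : P.Inst → WeightedGraph) (V E : Template)
    (f : P.Inst → Q.Inst) (hg : ∀ x, P.encInst x = (g x).enc)
    (hf : ∀ x, Q.encInst (f x) = translation V E (g x).numVertices (g x).enc)
    (hout : ∀ x (ε : ℝ), 0 < ε → ε < 1 → ∀ y, Q.IsApprox ((2 : ℝ) ^ ε) (f x) y →
      ∃ z, P.encSol x z = decoding (g x).numVertices (Q.encSol (f x) y) ∧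
        P.IsApprox ((2 : ℝ) ^ ε) x z) :
    APTReduces P Q := by
  refine aptReduces_of_singleQuery (translateGraph V E) decodeLoop
    (2 * V.ops.length + 2 * E.ops.length + 120) f
    (fun x => decoding (g x).numVertices) (fun x ε => ?_) hout
  refine ⟨_, (g x).numVertices * 30 + 1, ?_, (translateGraph_meets (n := (g x).numVertices)
    (by simp [hg, WeightedGraph.enc])).mono le_rfl ?_⟩
  -- The head of the input is the number of vertices, and naturals are measured in unary.
  · have hn : (g x).numVertices ≤ (P.encInst x).size := by
      simp only [hg, Word.size, WeightedGraph.enc, List.map_cons, List.sum_cons]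
      omega
    refine le_trans ?_ (Nat.mul_le_mul_left _ (Nat.pow_le_pow_left (Nat.succ_le_succ hn) 2))
    rw [Nat.succ_eq_add_one]
    generalize (g x).numVertices = n
    generalize V.ops.length = a
    generalize E.ops.length = b
    have : 0 ≤ a * n * n := by positivity
    have : 0 ≤ b * n := by positivity
    nlinarith
  · rintro s ⟨h0, h1, h2, h7, h8, hr, hm, hm'⟩
    refine ⟨by rw [hm, hf, hg], hr, fun a => ?_⟩
    refine (decodeLoop_meets (s := s.setMem 2 a) (n := (g x).numVertices) h0 h1 h2 h7 h8 ?_).mono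
      le_rfl fun s h => ?_
    · simpa [Store.setMem] using hm'
    · simpa [Store.setMem] using h

/-! ### Approximate solutions -/

/-- Only the lower bound on the ratio has content, since no measure exceeds the maximum. This form,
without division or explicit optimum, and its converse below are how ratios pass between the
problems. -/
theorem MaxProblem.IsApprox.measure_le {P : MaxProblem} {α : ℝ} {x : P.Inst} {y : P.Sol x}
    (h : P.IsApprox α x y) (hα : 0 < α) (y' : P.Sol x) :
    (P.measure x y' : ℝ) ≤ α * P.measure x y := by
  obtain ⟨m, hm, -, h1⟩ := h
  have hy' : (P.measure x y' : ℝ) ≤ m := NNReal.coe_le_coe.2 (hm.2 ⟨y', rfl⟩)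
  refine hy'.trans ?_
  by_cases h : m = 0
  · rw [h, NNReal.coe_zero]
    positivity
  · have hm0 : (0 : ℝ) < m := NNReal.coe_pos.2 (pos_iff_ne_zero.2 h)
    have := (h1 h).1
    rw [abs_of_nonneg (by positivity), div_le_div_iff₀ hα hm0] at this
    linarith

theorem MaxProblem.isApprox_of_measure_le {P : MaxProblem} {α : ℝ} {x : P.Inst}
    [Finite (P.Sol x)] {y : P.Sol x} (hα : 1 ≤ α)
    (h : ∀ y', (P.measure x y' : ℝ) ≤ α * P.measure x y) : P.IsApprox α x y := by
  have : Nonempty (P.Sol x) := ⟨y⟩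
  obtain ⟨y₀, hy₀⟩ := Finite.exists_max (P.measure x)
  refine ⟨P.measure x y₀, ⟨⟨y₀, rfl⟩, ?_⟩, fun h0 => ?_, fun h0 => ?_⟩
  · rintro _ ⟨y', rfl⟩
    exact hy₀ y'
  · exact le_antisymm (h0 ▸ hy₀ y) zero_le
  · have hm0 : (0 : ℝ) < P.measure x y₀ := NNReal.coe_pos.2 (pos_iff_ne_zero.2 h0)
    have hy : (P.measure x y : ℝ) ≤ P.measure x y₀ := NNReal.coe_le_coe.2 (hy₀ y)
    rw [abs_of_nonneg (by positivity), div_le_div_iff₀ (by linarith) hm0, div_le_iff₀ hm0]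
    exact ⟨by linarith [h y₀], by nlinarith⟩

/-! ### Instances built from constraints at the vertices and the edges of a graph -/

theorem List.flatMap_finRange {β : Type*} (n : ℕ) (f : ℕ → List β) :
    (List.finRange n).flatMap (fun u : Fin n => f u) = (List.range n).flatMap f := by
  rw [← List.map_coe_finRange_eq_range, List.flatMap_map]

theorem List.prod_map_flatMap {α β M : Type*} [Monoid M] (l : List α) (f : α → List β)
    (g : β → M) : ((l.flatMap f).map g).prod = (l.map fun a => ((f a).map g).prod).prod := by
  induction l with
  | nil => simp
  | cons a l ih => simp [ih]

namespace WeightedGraph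

open Classical in
theorem enc_nats_getD (x : WeightedGraph) (u v : Fin x.numVertices) :
    x.enc.nats.getD (x.numVertices * u + v + 1) 0 = if x.graph.Adj u v then 1 else 0 := by
  have hlt : x.numVertices * u + v < x.numVertices * x.numVertices := by
    have := u.2
    have := v.2
    nlinarith
  have hu : Fin.divNat (m := x.numVertices) ⟨_, hlt⟩ = u := by
    ext
    simp [Fin.divNat, Nat.mul_add_div u.pos, Nat.div_eq_of_lt v.2]
  have hv : Fin.modNat (m := x.numVertices) ⟨_, hlt⟩ = v := by
    ext
    simp [Fin.modNat, Nat.mod_eq_of_lt v.2]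
  simp [enc, hlt, hu, hv]

theorem enc_reals_getD (x : WeightedGraph) (u : Fin x.numVertices) :
    x.enc.reals.getD u 0 = x.weight u := by
  simp [enc]

/-- Applications of constraints from `F` to `4 n` variables, four for each of the `n` vertices of
`x`, whose encoding is given by the templates `V` and `E`. -/
structure Localized (x : WeightedGraph) (F : Set Constraint) (V E : Template) where
  atVertex : Fin x.numVertices → List (ConstraintApp (4 * x.numVertices))
  atEdge : Fin x.numVertices → Fin x.numVertices → List (ConstraintApp (4 * x.numVertices))
  atVertex_nodup : ∀ u, (atVertex u).Nodup
  atEdge_nodup : ∀ u v, (atEdge u v).Nodup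
  atVertex_mem : ∀ u, ∀ a ∈ atVertex u, a.con ∈ F
  atEdge_mem : ∀ u v, ∀ a ∈ atEdge u v, a.con ∈ F
  atVertex_var : ∀ u, ∀ a ∈ atVertex u, a.con.arity = 1 ∧ a.natCode.getD 1 0 / 4 = u
  atEdge_var : ∀ u v, ∀ a ∈ atEdge u v,
    a.con.arity = 2 ∧ a.natCode.getD 1 0 / 4 = u ∧ a.natCode.getD 2 0 / 4 = v
  atVertex_nats : ∀ u : Fin x.numVertices,
    (atVertex u).flatMap ConstraintApp.natCode = V.natWord u 0
  atVertex_reals : ∀ u : Fin x.numVertices,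
    (atVertex u).flatMap ConstraintApp.realCode = V.realWord (4 ^ 2 ^ (u : ℕ)) (x.weight u)
  atEdge_nats : ∀ u v : Fin x.numVertices,
    (atEdge u v).flatMap ConstraintApp.natCode = E.natWord u v
  atEdge_reals : ∀ u v : Fin x.numVertices,
    (atEdge u v).flatMap ConstraintApp.realCode = E.realWord 0 0

namespace Localized

variable {x : WeightedGraph} {F : Set Constraint} {V E : Template}

open Classical in
def edgeApps (L : x.Localized F V E) (u v : Fin x.numVertices) :
    List (ConstraintApp (4 * x.numVertices)) := if x.graph.Adj u v then L.atEdge u v else []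

theorem mem_atEdge {L : x.Localized F V E} {u v : Fin x.numVertices}
    {a : ConstraintApp (4 * x.numVertices)} (h : a ∈ L.edgeApps u v) : a ∈ L.atEdge u v := by
  unfold edgeApps at h
  split_ifs at h with hA
  · exact h
  · simp at h

def apps (L : x.Localized F V E) : List (ConstraintApp (4 * x.numVertices)) :=
  (List.finRange x.numVertices).flatMap L.atVertex ++
    (List.finRange x.numVertices).flatMap fun u =>
      (List.finRange x.numVertices).flatMap fun v => L.edgeApps u v

/-- Dividing the variables of an application by 4 recovers its vertex or its ordered pair, and the
arity separates vertices from edges. -/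
theorem nodup_apps (L : x.Localized F V E) : L.apps.Nodup := by
  refine List.nodup_append.2 ⟨List.nodup_flatMap.2 ⟨fun u _ => L.atVertex_nodup u, ?_⟩,
    List.nodup_flatMap.2 ⟨fun u _ => List.nodup_flatMap.2 ⟨fun v _ => ?_, ?_⟩, ?_⟩, ?_⟩
  · refine (List.nodup_finRange _).imp fun {u v} huv a hu hv => huv (Fin.ext ?_)
    rw [← (L.atVertex_var u a hu).2, (L.atVertex_var v a hv).2]
  · unfold edgeApps
    split_ifs
    · exact L.atEdge_nodup u v
    · exact List.nodup_nil
  · refine (List.nodup_finRange _).imp fun {v v'} hvv a hv hv' => hvv (Fin.ext ?_)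
    rw [← (L.atEdge_var u v a (mem_atEdge hv)).2.2, (L.atEdge_var u v' a (mem_atEdge hv')).2.2]
  · refine (List.nodup_finRange _).imp fun {u u'} huu a hu hu' => huu (Fin.ext ?_)
    obtain ⟨v, -, hv⟩ := List.mem_flatMap.1 hu
    obtain ⟨v', -, hv'⟩ := List.mem_flatMap.1 hu'
    rw [← (L.atEdge_var u v a (mem_atEdge hv)).2.1, (L.atEdge_var u' v' a (mem_atEdge hv')).2.1]
  · rintro a ha b hb rfl
    obtain ⟨u, -, hu⟩ := List.mem_flatMap.1 ha
    obtain ⟨u', -, hu'⟩ := List.mem_flatMap.1 hb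
    obtain ⟨v, -, hv⟩ := List.mem_flatMap.1 hu'
    have h1 := (L.atVertex_var u a hu).1
    have h2 := (L.atEdge_var u' v a (mem_atEdge hv)).1
    omega

/-- The instance consisting of all constraints at vertices and at edges. -/
def inst (L : x.Localized F V E) : CSPInst F where
  numVars := 4 * x.numVertices
  apps := L.apps
  nodup := L.nodup_apps
  mem := by
    intro a ha
    rcases List.mem_append.1 ha with ha | ha
    · obtain ⟨u, -, hu⟩ := List.mem_flatMap.1 ha
      exact L.atVertex_mem u a hu
    · obtain ⟨u, -, hu⟩ := List.mem_flatMap.1 ha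
      obtain ⟨v, -, hv⟩ := List.mem_flatMap.1 hu
      exact L.atEdge_mem u v a (mem_atEdge hv)

theorem enc_inst (L : x.Localized F V E) :
    L.inst.enc = translation V E x.numVertices x.enc := by
  ext1
  · simp only [CSPInst.enc, inst, apps, translation, neighbourNats, ← List.flatMap_finRange,
      List.flatMap_append, List.flatMap_assoc, List.cons_append, enc_nats_getD]
    simp only [L.atVertex_nats, edgeApps]
    congr 2
    refine List.flatMap_congr fun u _ => List.flatMap_congr fun v _ => ?_
    split_ifs <;> simp_all [L.atEdge_nats]
  · simp only [CSPInst.enc, inst, apps, translation, neighbourReals, ← List.flatMap_finRange,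
      List.flatMap_append, List.flatMap_assoc, enc_nats_getD, enc_reals_getD]
    simp only [L.atVertex_reals, edgeApps]
    congr 1
    refine List.flatMap_congr fun u _ => List.flatMap_congr fun v _ => ?_
    split_ifs <;> simp_all [L.atEdge_reals]

open Classical in
theorem measure_inst (L : x.Localized F V E) (σ : Fin (4 * x.numVertices) → Bool) :
    L.inst.measure σ =
      (∏ u, ((L.atVertex u).map fun a => a.con.val fun j => σ (a.vars j)).prod) *
        ∏ u, ∏ v, if x.graph.Adj u v then
          ((L.atEdge u v).map fun a => a.con.val fun j => σ (a.vars j)).prod else 1 := by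
  simp only [CSPInst.measure, inst, apps, List.map_append, List.prod_append,
    List.prod_map_flatMap, Fin.prod_univ_def]
  congr 3
  funext u
  congr 2
  funext v
  unfold edgeApps
  split_ifs <;> simp

end Localized

end WeightedGraph

/-- The `k`-th variable of the vertex `u`. -/
def vertexVar {n : ℕ} (u : Fin n) (k : Fin 4) : Fin (4 * n) := ⟨4 * u + k, by omega⟩

/-- The assignment with value `τ u k` at the `k`-th variable of the vertex `u`. -/
def assignment {n : ℕ} (τ : Fin n → Fin 4 → Bool) (i : Fin (4 * n)) : Bool :=
  τ ⟨i / 4, by omega⟩ ⟨i % 4, by omega⟩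

theorem assignment_vertexVar {n : ℕ} (τ : Fin n → Fin 4 → Bool) (u : Fin n) (k : Fin 4) :
    assignment τ (vertexVar u k) = τ u k := by
  unfold assignment vertexVar
  congr 1
  · congr 1
    simp only
    omega
  · ext
    simp only
    omega

/-- Variable 2 selects between the two readings. Under `OR` it is forced to be false; under
`Implies` it is the colour of the vertex. -/
theorem decoding_bitWord {n : ℕ} (σ : Fin (4 * n) → Bool) :
    decoding n (bitWord σ) = bitWord fun u : Fin n =>
      if σ (vertexVar u 2) then σ (vertexVar u 0) else !σ (vertexVar u 1) := by
  have h : ∀ (u : Fin n) (k : Fin 4),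
      (bitWord σ).nats.getD (4 * u + k) 0 = (σ (vertexVar u k)).toNat := by
    intro u k
    have : 4 * (u : ℕ) + k < 4 * n := by omega
    simp [bitWord, this, vertexVar]
  ext1
  · simp only [decoding, bitWord, ← List.map_coe_finRange_eq_range, List.map_map, List.ofFn_eq_map]
    refine List.map_congr_left fun u _ => ?_
    have h0 := h u 0
    have h1 := h u 1
    have h2 := h u 2
    simp only [bitWord, Fin.val_zero, Fin.val_one, Fin.val_two, Nat.add_zero] at h0 h1 h2
    simp only [Function.comp_apply, decodeBit, ← List.ofFn_eq_map, h0, h1, h2]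
    cases σ (vertexVar u 0) <;> cases σ (vertexVar u 1) <;> cases σ (vertexVar u 2) <;> rfl
  · rfl

/-- The unary constraint `(a, b)` at the variable `i`. -/
def unaryApp {m : ℕ} (i : Fin m) (a b : ℝ≥0) : ConstraintApp m :=
  ⟨⟨1, fun t => if t 0 then b else a⟩, fun _ => i⟩

/-- The constraint `c` at the variables `i` and `j`. -/
def binaryApp {m : ℕ} (c : (Fin 2 → Bool) → ℝ≥0) (i j : Fin m) : ConstraintApp m :=
  ⟨⟨2, c⟩, ![i, j]⟩

/-! ### Codes and values of unary and binary applications -/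

section

variable {m : ℕ} (i j : Fin m) (a b : ℝ≥0) (c : (Fin 2 → Bool) → ℝ≥0)

theorem unaryApp_natCode : (unaryApp i a b).natCode = [1, (i : ℕ)] := by
  simp [ConstraintApp.natCode, unaryApp]

theorem unaryApp_realCode : (unaryApp i a b).realCode = [(a : ℝ), (b : ℝ)] := by
  simp [ConstraintApp.realCode, unaryApp, valueTable]

theorem binaryApp_natCode : (binaryApp c i j).natCode = [2, (i : ℕ), (j : ℕ)] := by
  simp [ConstraintApp.natCode, binaryApp]

theorem binaryApp_realCode : (binaryApp c i j).realCode = [(c ![false, false] : ℝ),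
    (c ![false, true] : ℝ), (c ![true, false] : ℝ), (c ![true, true] : ℝ)] := by
  have h : ∀ s t : Bool, (Fin.cons s (Fin.cons t Fin.elim0) : Fin 2 → Bool) = ![s, t] := by
    intro s t
    funext i
    fin_cases i <;> rfl
  simp [ConstraintApp.realCode, binaryApp, valueTable, h]

theorem unaryApp_val (σ : Fin m → Bool) :
    ((unaryApp i a b).con.val fun k => σ ((unaryApp i a b).vars k)) = if σ i then b else a := rfl

theorem binaryApp_val (σ : Fin m → Bool) :
    ((binaryApp c i j).con.val fun k => σ ((binaryApp c i j).vars k)) = c ![σ i, σ j] := by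
  change c _ = c _
  congr 1
  funext k
  fin_cases k <;> rfl

end

/-! ### Independent sets and `OR` -/

/-- `(w, 1)` at variable `1` and `(1, 0)` at variable `2` of each vertex. -/
def orVertexTemplate : Template :=
  ⟨[.const 1, .fst 1, .const 1, .fst 2], [.weight, .one, .one, .zero]⟩

/-- `OR` at the variables `1` of adjacent vertices. -/
def orEdgeTemplate : Template := ⟨[.const 2, .fst 1, .snd 1], [.zero, .one, .one, .one]⟩

/-- The values of `OR`. -/
def orValue (t : Fin 2 → Bool) : ℝ≥0 := if t 0 = true ∨ t 1 = true then 1 else 0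

theorem orValue_pair (a b : Bool) : orValue ![a, b] = if a || b then 1 else 0 := by
  cases a <;> cases b <;> simp [orValue]

/-- A vertex is selected when variable 1 is false, so `OR` forbids selecting both ends of an edge.
The constraint (1, 0) at variable 2 only serves the shared decoder, making it read the negation of
variable 1. -/
def orLocalized (x : WeightedGraph) :
    x.Localized ({constraintOR} ∪ unaryConstraints) orVertexTemplate orEdgeTemplate where
  atVertex u := [unaryApp (vertexVar u 1) (x.weight u) 1, unaryApp (vertexVar u 2) 1 0]
  atEdge u v := [binaryApp orValue (vertexVar u 1) (vertexVar v 1)]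
  atVertex_nodup u := by
    refine List.Nodup.of_map ConstraintApp.natCode ?_
    simp [unaryApp_natCode, vertexVar]
  atEdge_nodup u v := by simp
  atVertex_mem u := by simp [unaryConstraints, unaryApp]
  atEdge_mem u v := by
    simp only [List.mem_singleton, forall_eq]
    exact Or.inl rfl
  atVertex_var u := by
    simp only [List.mem_cons, List.not_mem_nil, or_false, forall_eq_or_imp, forall_eq,
      unaryApp_natCode]
    refine ⟨⟨rfl, ?_⟩, rfl, ?_⟩ <;> simp [vertexVar] <;> omega
  atEdge_var u v := by
    simp only [List.mem_singleton, forall_eq, binaryApp_natCode]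
    refine ⟨rfl, ?_, ?_⟩ <;> simp [vertexVar] <;> omega
  atVertex_nats u := by
    simp [unaryApp_natCode, vertexVar, orVertexTemplate, Template.natWord, NatSource.value]
  atVertex_reals u := by
    simp [unaryApp_realCode, orVertexTemplate, Template.realWord, RealSource.value]
  atEdge_nats u v := by
    simp [binaryApp_natCode, vertexVar, orEdgeTemplate, Template.natWord, NatSource.value]
  atEdge_reals u v := by
    simp [binaryApp_realCode, orEdgeTemplate, Template.realWord, RealSource.value, orValue_pair]

open Classical in
theorem measure_orLocalized (x : WeightedGraph) (σ : Fin (4 * x.numVertices) → Bool) :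
    (orLocalized x).inst.measure σ =
      (∏ u, (if σ (vertexVar u 1) then 1 else x.weight u) *
        (if σ (vertexVar u 2) then 0 else 1)) *
      ∏ u, ∏ v, if x.graph.Adj u v then
        (if σ (vertexVar u 1) || σ (vertexVar v 1) then 1 else 0) else 1 := by
  rw [WeightedGraph.Localized.measure_inst]
  simp only [orLocalized, List.map_cons, List.map_nil, unaryApp_val, binaryApp_val,
    List.prod_cons, List.prod_nil, mul_one, orValue_pair]

theorem WeightedGraph.measure_eq_prod_ite (x : WeightedGraph) (A : x.IndepSet) :
    x.measure A = ∏ u, if u ∈ A.1 then x.weight u else 1 := by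
  simp [WeightedGraph.measure]

theorem measure_orLocalized_indepSet (x : WeightedGraph) (B : x.IndepSet) :
    (orLocalized x).inst.measure (assignment fun u => ![false, decide (u ∉ B.1), false, false]) =
      x.measure B := by
  classical
  rw [measure_orLocalized, x.measure_eq_prod_ite]
  simp only [assignment_vertexVar, Matrix.cons_val]
  rw [Finset.prod_eq_one (f := fun u => ∏ v, _), mul_one]
  · refine Finset.prod_congr rfl fun u _ => ?_
    by_cases hu : u ∈ B.1 <;> simp [hu]
  · refine fun u _ => Finset.prod_eq_one fun v _ => ?_
    split_ifs with hA hB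
    · rfl
    · simp only [Bool.or_eq_true, decide_eq_true_eq, not_or, not_not] at hB
      exact (B.2 hB.1 hB.2 hA.ne hA).elim
    · rfl

/-- When the product is nonzero, all `OR` and (1, 0) factors equal 1, and only the weights of the
selected vertices remain. -/
theorem exists_indepSet_of_orLocalized (x : WeightedGraph) (σ : Fin (4 * x.numVertices) → Bool)
    (hσ : (orLocalized x).inst.measure σ ≠ 0) :
    ∃ A : x.IndepSet, x.encSol A = decoding x.numVertices (bitWord σ) ∧
      x.measure A = (orLocalized x).inst.measure σ := by
  classical
  rw [measure_orLocalized] at hσ ⊢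
  obtain ⟨h1, h2⟩ := mul_ne_zero_iff.1 hσ
  have h3 : ∀ u, σ (vertexVar u 2) = false := by
    intro u
    have := Finset.prod_ne_zero_iff.1 h1 u (Finset.mem_univ u)
    by_contra h
    simp [h] at this
  have h4 : ∀ u v, x.graph.Adj u v → (σ (vertexVar u 1) || σ (vertexVar v 1)) = true := by
    intro u v huv
    have := Finset.prod_ne_zero_iff.1 (Finset.prod_ne_zero_iff.1 h2 u (Finset.mem_univ u)) v
      (Finset.mem_univ v)
    by_contra h
    simp [h, huv] at this
  refine ⟨⟨Finset.univ.filter fun u => σ (vertexVar u 1) = false, ?_⟩, ?_, ?_⟩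
  · intro u hu v hv _ huv
    have := h4 u v huv
    simp_all
  · rw [decoding_bitWord]
    simp only [WeightedGraph.encSol]
    congr 1
    funext u
    cases h : σ (vertexVar u 1) <;> simp [h3, h]
  · rw [x.measure_eq_prod_ite, Finset.prod_eq_one (f := fun u => ∏ v, _), mul_one]
    · refine Finset.prod_congr rfl fun u _ => ?_
      cases h : σ (vertexVar u 1) <;> simp [h3, h]
    · refine fun u _ => Finset.prod_eq_one fun v _ => ?_
      split_ifs with hA hB
      · rfl
      · exact (hB (h4 u v hA)).elim
      · rfl

theorem maxProdIS_aptReduces : APTReduces maxProdIS (maxProdCSPStar {constraintOR}) := by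
  refine aptReduces_of_templates (P := maxProdIS) (fun x => x) orVertexTemplate orEdgeTemplate
    (fun x => (orLocalized x).inst) (fun _ => rfl) (fun x => (orLocalized x).enc_inst) ?_
  intro x ε h0 _ σ hσ
  change Fin (4 * WeightedGraph.numVertices x) → Bool at σ
  have hα : (0 : ℝ) < 2 ^ ε := by positivity
  have hle : ∀ B : WeightedGraph.IndepSet x, (WeightedGraph.measure x B : ℝ) ≤
      2 ^ ε * (orLocalized x).inst.measure σ := by
    intro B
    rw [← measure_orLocalized_indepSet x B]
    exact hσ.measure_le hα _
  -- The empty set has measure 1, which no multiple of 0 can bound.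
  have hne : (orLocalized x).inst.measure σ ≠ 0 := by
    intro h
    have := hle ⟨∅, by simp⟩
    rw [h] at this
    simp [WeightedGraph.measure] at this
    linarith
  obtain ⟨A, hA, hA'⟩ := exists_indepSet_of_orLocalized x σ hne
  have : Finite (maxProdIS.Sol x) := inferInstanceAs (Finite (WeightedGraph.IndepSet x))
  refine ⟨A, hA, MaxProblem.isApprox_of_measure_le (Real.one_le_rpow (by norm_num) h0.le) ?_⟩
  intro B
  rw [← hA'] at hle
  exact hle B

/-! ### Bipartite graphs and `Implies` -/

/-- Variables `0` and `1` of a vertex describe an independent set of the bipartite double cover,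
variables `2` and `3` a colouring of the graph. -/
def impliesVertexTemplate : Template :=
  ⟨[.const 1, .fst 0, .const 1, .fst 1, .const 1, .fst 2, .const 1, .fst 3],
    [.one, .weight, .weight, .one, .one, .tag, .tag, .one]⟩

def impliesEdgeTemplate : Template :=
  ⟨[.const 2, .fst 0, .snd 1, .const 2, .fst 2, .snd 3, .const 2, .fst 3, .snd 2],
    [.one, .one, .zero, .one, .one, .one, .zero, .one, .one, .one, .zero, .one]⟩

/-- The values of `Implies`. -/
def impliesValue (t : Fin 2 → Bool) : ℝ≥0 := if t 0 = true → t 1 = true then 1 else 0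

theorem impliesValue_pair (a b : Bool) : impliesValue ![a, b] = if !a || b then 1 else 0 := by
  cases a <;> cases b <;> simp [impliesValue]

/-- In the double cover, the first copy of a vertex is selected when variable 0 is true, the second
when variable 1 is false; the first implication is then independence. The other two, taken over both
orders of an edge, equate variable 2 at one end with variable 3 at the other. -/
def impliesLocalized (x : WeightedGraph) :
    x.Localized ({constraintImplies} ∪ unaryConstraints) impliesVertexTemplate
      impliesEdgeTemplate where
  atVertex u := [unaryApp (vertexVar u 0) 1 (x.weight u), unaryApp (vertexVar u 1) (x.weight u) 1,
    unaryApp (vertexVar u 2) 1 (4 ^ 2 ^ (u : ℕ)), unaryApp (vertexVar u 3) (4 ^ 2 ^ (u : ℕ)) 1]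
  atEdge u v := [binaryApp impliesValue (vertexVar u 0) (vertexVar v 1),
    binaryApp impliesValue (vertexVar u 2) (vertexVar v 3),
    binaryApp impliesValue (vertexVar u 3) (vertexVar v 2)]
  atVertex_nodup u := by
    refine List.Nodup.of_map ConstraintApp.natCode ?_
    simp [unaryApp_natCode, vertexVar]
  atEdge_nodup u v := by
    refine List.Nodup.of_map ConstraintApp.natCode ?_
    simp [binaryApp_natCode, vertexVar]
  atVertex_mem u := by simp [unaryConstraints, unaryApp]
  atEdge_mem u v := by
    simp only [List.mem_cons, List.not_mem_nil, or_false, forall_eq_or_imp, forall_eq]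
    exact ⟨Or.inl rfl, Or.inl rfl, Or.inl rfl⟩
  atVertex_var u := by
    simp only [List.mem_cons, List.not_mem_nil, or_false, forall_eq_or_imp, forall_eq,
      unaryApp_natCode]
    refine ⟨⟨rfl, ?_⟩, ⟨rfl, ?_⟩, ⟨rfl, ?_⟩, rfl, ?_⟩ <;> simp [vertexVar] <;> omega
  atEdge_var u v := by
    simp only [List.mem_cons, List.not_mem_nil, or_false, forall_eq_or_imp, forall_eq,
      binaryApp_natCode]
    refine ⟨⟨rfl, ?_, ?_⟩, ⟨rfl, ?_, ?_⟩, rfl, ?_, ?_⟩ <;> simp [vertexVar] <;> omega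
  atVertex_nats u := by
    simp [unaryApp_natCode, vertexVar, impliesVertexTemplate, Template.natWord, NatSource.value]
  atVertex_reals u := by
    simp [unaryApp_realCode, impliesVertexTemplate, Template.realWord, RealSource.value]
  atEdge_nats u v := by
    simp [binaryApp_natCode, vertexVar, impliesEdgeTemplate, Template.natWord, NatSource.value]
  atEdge_reals u v := by
    simp [binaryApp_realCode, impliesEdgeTemplate, Template.realWord, RealSource.value,
      impliesValue_pair]

/-! ### Feasible assignments, forced colourings and pairs of independent sets -/

namespace WeightedGraph

variable (x : WeightedGraph)

/-- The assignment satisfies all implications along the edges. -/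
def Feasible (σ : Fin (4 * x.numVertices) → Bool) : Prop :=
  ∀ u v, x.graph.Adj u v → (σ (vertexVar u 0) → σ (vertexVar v 1)) ∧
    (σ (vertexVar u 2) → σ (vertexVar v 3)) ∧ (σ (vertexVar u 3) → σ (vertexVar v 2))

variable {x} in
theorem measure_impliesLocalized {σ : Fin (4 * x.numVertices) → Bool} (h : x.Feasible σ) :
    (impliesLocalized x).inst.measure σ =
      ∏ u, (if σ (vertexVar u 0) then x.weight u else 1) *
        ((if σ (vertexVar u 1) then 1 else x.weight u) *
        ((if σ (vertexVar u 2) then 4 ^ 2 ^ (u : ℕ) else 1) *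
        (if σ (vertexVar u 3) then 1 else 4 ^ 2 ^ (u : ℕ)))) := by
  classical
  rw [Localized.measure_inst, Finset.prod_eq_one (f := fun u => ∏ v, _), mul_one]
  · simp only [impliesLocalized, List.map_cons, List.map_nil, unaryApp_val, List.prod_cons,
      List.prod_nil, mul_one]
  · refine fun u _ => Finset.prod_eq_one fun v _ => ?_
    split_ifs with hA
    · obtain ⟨h1, h2, h3⟩ := h u v hA
      simp only [impliesLocalized, List.map_cons, List.map_nil, binaryApp_val, List.prod_cons,
        List.prod_nil, mul_one, impliesValue_pair]
      rw [if_pos (by grind), if_pos (by grind), if_pos (by grind), mul_one, mul_one]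
    · rfl

variable {x} in
theorem feasible_of_measure_ne_zero {σ : Fin (4 * x.numVertices) → Bool}
    (h : (impliesLocalized x).inst.measure σ ≠ 0) : x.Feasible σ := by
  classical
  rw [Localized.measure_inst] at h
  intro u v huv
  have := Finset.prod_ne_zero_iff.1 (Finset.prod_ne_zero_iff.1 (mul_ne_zero_iff.1 h).2 u
    (Finset.mem_univ u)) v (Finset.mem_univ v)
  simp only [impliesLocalized, List.map_cons, List.map_nil, binaryApp_val, List.prod_cons,
    List.prod_nil, mul_one, impliesValue_pair, if_pos huv, mul_ne_zero_iff,
    ite_ne_right_iff] at this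
  grind

variable {x} in
/-- Recolour by `χ` the vertices whose variables `2` and `3` agree. -/
def recolour (χ : Fin x.numVertices → Bool) (σ : Fin (4 * x.numVertices) → Bool) :
    Fin (4 * x.numVertices) → Bool :=
  assignment fun u => if σ (vertexVar u 2) = σ (vertexVar u 3) then
      ![σ (vertexVar u 0), σ (vertexVar u 1), χ u, !χ u]
    else ![σ (vertexVar u 0), σ (vertexVar u 1), σ (vertexVar u 2), σ (vertexVar u 3)]

variable {x}
variable {σ : Fin (4 * x.numVertices) → Bool} {χ : Fin x.numVertices → Bool}

/-- Along an edge the implications in both directions exchange the values of variables 2 and 3.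
Hence the vertices where these agree form a union of components, and recolouring never touches one
end of an edge alone. -/
theorem Feasible.recolour (h : x.Feasible σ) (hχ : ∀ u v, x.graph.Adj u v → χ u ≠ χ v) :
    x.Feasible (recolour χ σ) := by
  intro u v huv
  obtain ⟨h1, h2, h3⟩ := h u v huv
  obtain ⟨-, h2', h3'⟩ := h v u huv.symm
  have hc := hχ u v huv
  simp only [WeightedGraph.recolour, assignment_vertexVar]
  by_cases hu : σ (vertexVar u 2) = σ (vertexVar u 3) <;>
    by_cases hv : σ (vertexVar v 2) = σ (vertexVar v 3) <;>
    simp only [hu, hv, if_true, if_false, Matrix.cons_val] <;> grind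

/-- The effect of recolouring on the measure, in a form without division. -/
theorem measure_recolour (h : x.Feasible σ) (hχ : ∀ u v, x.graph.Adj u v → χ u ≠ χ v) :
    (impliesLocalized x).inst.measure (recolour χ σ) *
      ∏ u with σ (vertexVar u 2) = σ (vertexVar u 3) ∧ χ u = false, 4 ^ 2 ^ (u : ℕ) =
    (impliesLocalized x).inst.measure σ *
      ∏ u with σ (vertexVar u 2) = σ (vertexVar u 3) ∧ χ u = true, 4 ^ 2 ^ (u : ℕ) := by
  rw [measure_impliesLocalized h, measure_impliesLocalized (h.recolour hχ), Finset.prod_filter,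
    Finset.prod_filter, ← Finset.prod_mul_distrib, ← Finset.prod_mul_distrib]
  refine Finset.prod_congr rfl fun u _ => ?_
  simp only [recolour, assignment_vertexVar]
  -- Where the two variables agree, exactly one of them earns the tag; after recolouring both do if
  -- `χ u` holds, and neither otherwise.
  by_cases hu : σ (vertexVar u 2) = σ (vertexVar u 3)
  · cases h3 : σ (vertexVar u 3) <;> cases hc : χ u <;> simp [hu, h3] <;> ring_nf
  · simp [hu]

theorem prod_tag (s : Finset (Fin x.numVertices)) :
    ∏ u ∈ s, (4 : ℝ≥0) ^ 2 ^ (u : ℕ) = 4 ^ ∑ i ∈ s.map Fin.valEmbedding, 2 ^ i := by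
  rw [Finset.prod_pow_eq_pow_sum, Finset.sum_map]
  rfl

/-- Exponents are integers, so an excess would cost a full factor 4, which a ratio below 4 cannot
absorb. -/
theorem le_of_four_pow_le {a b : ℕ} {α : ℝ} (hα : α < 4) (h : (4 : ℝ) ^ a ≤ α * 4 ^ b) :
    a ≤ b := by
  by_contra hab
  have h1 : (4 : ℝ) ^ (b + 1) ≤ 4 ^ a := pow_le_pow_right₀ (by norm_num) (by omega)
  have h2 : (0 : ℝ) < 4 ^ b := by positivity
  rw [pow_succ] at h1
  nlinarith

/-- In a nearly optimal assignment, variables `2` and `3` form a proper colouring. -/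
theorem ne_of_nearly_optimal {α : ℝ} (hα : α < 4) (hχ : ∀ u v, x.graph.Adj u v → χ u ≠ χ v)
    (h0 : (impliesLocalized x).inst.measure σ ≠ 0)
    (h : ∀ τ, ((impliesLocalized x).inst.measure τ : ℝ) ≤
      α * (impliesLocalized x).inst.measure σ) (u : Fin x.numVertices) :
    σ (vertexVar u 2) ≠ σ (vertexVar u 3) := by
  have hσ := feasible_of_measure_ne_zero h0
  have hpos : (0 : ℝ) < (impliesLocalized x).inst.measure σ :=
    NNReal.coe_pos.2 (pos_iff_ne_zero.2 h0)
  have key : ∀ χ : Fin x.numVertices → Bool, (∀ u v, x.graph.Adj u v → χ u ≠ χ v) →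
      ∑ i ∈ (Finset.univ.filter fun u => σ (vertexVar u 2) = σ (vertexVar u 3) ∧
        χ u = true).map Fin.valEmbedding, 2 ^ i ≤
      ∑ i ∈ (Finset.univ.filter fun u => σ (vertexVar u 2) = σ (vertexVar u 3) ∧
        χ u = false).map Fin.valEmbedding, 2 ^ i := by
    intro χ hχ
    have hm := congrArg NNReal.toReal (measure_recolour hσ hχ)
    rw [prod_tag, prod_tag] at hm
    push_cast at hm
    refine le_of_four_pow_le hα (le_of_mul_le_mul_left ?_ hpos)
    rw [← hm]
    refine (mul_le_mul_of_nonneg_right (h _) (by positivity)).trans (le_of_eq (by ring))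
  have h1 := key χ hχ
  have h2 := key (fun u => !χ u) fun u v huv => by simpa using hχ u v huv
  simp only [Bool.not_eq_true', Bool.not_eq_false'] at h2
  -- Both inequalities together make the binary sums equal, hence also the two colour classes of
  -- agreeing vertices. These classes are disjoint, so no agreeing vertex exists.
  have h3 := Finset.map_injective _ (Finset.geomSum_injective le_rfl (le_antisymm h1 h2))
  intro hu
  have h4 := Finset.ext_iff.1 h3 u
  cases hc : χ u <;> simp [hu, hc] at h4

/-- Combine two independent sets along a colouring `c`. -/
def combine (c : Fin x.numVertices → Bool) (A B : Finset (Fin x.numVertices)) :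
    Fin (4 * x.numVertices) → Bool :=
  assignment fun u => ![if c u then decide (u ∈ A) else decide (u ∈ B),
    if c u then decide (u ∉ B) else decide (u ∉ A), c u, !c u]

theorem feasible_combine (A B : x.IndepSet) (hχ : ∀ u v, x.graph.Adj u v → χ u ≠ χ v) :
    x.Feasible (combine χ A.1 B.1) := by
  intro u v huv
  have hc := hχ u v huv
  have hA : u ∈ A.1 → v ∉ A.1 := fun hu hv => A.2 hu hv huv.ne huv
  have hB : u ∈ B.1 → v ∉ B.1 := fun hu hv => B.2 hu hv huv.ne huv
  simp only [combine, assignment_vertexVar, Matrix.cons_val]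
  cases hu : χ u <;> cases hv : χ v <;> simp_all

/-- The two sets exchange their places in the double cover according to the colour, so each uses
every vertex once. The tag factor depends on the colouring alone. -/
theorem measure_combine (A B : x.IndepSet) (hχ : ∀ u v, x.graph.Adj u v → χ u ≠ χ v) :
    (impliesLocalized x).inst.measure (combine χ A.1 B.1) = x.measure A * (x.measure B *
      ∏ u, (if χ u then 4 ^ 2 ^ (u : ℕ) else 1) * (if χ u then 4 ^ 2 ^ (u : ℕ) else 1)) := by
  rw [measure_impliesLocalized (feasible_combine A B hχ), x.measure_eq_prod_ite,
    x.measure_eq_prod_ite, ← Finset.prod_mul_distrib, ← Finset.prod_mul_distrib]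
  refine Finset.prod_congr rfl fun u _ => ?_
  simp only [combine, assignment_vertexVar, Matrix.cons_val]
  cases hu : χ u <;> by_cases hA : u ∈ A.1 <;> by_cases hB : u ∈ B.1 <;> simp [hA, hB]

/-- A feasible assignment whose variables `2` and `3` form a colouring comes from two independent
sets, the first of which is the one that is decoded. -/
theorem Feasible.exists_eq_combine (h : x.Feasible σ)
    (hc : ∀ u, σ (vertexVar u 2) ≠ σ (vertexVar u 3)) :
    ∃ A B : x.IndepSet, x.encSol A = decoding x.numVertices (bitWord σ) ∧
      (impliesLocalized x).inst.measure σ = (impliesLocalized x).inst.measure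
        (combine (fun u => σ (vertexVar u 2)) A.1 B.1) ∧
      ∀ u v, x.graph.Adj u v → σ (vertexVar u 2) ≠ σ (vertexVar v 2) := by
  have hχ : ∀ u v, x.graph.Adj u v → σ (vertexVar u 2) ≠ σ (vertexVar v 2) := by
    intro u v huv
    have := h u v huv
    have := h v u huv.symm
    have hu := hc u
    have hv := hc v
    cases h2 : σ (vertexVar u 2) <;> cases h3 : σ (vertexVar u 3) <;> simp_all
  let A : x.IndepSet := ⟨Finset.univ.filter fun u => (if σ (vertexVar u 2) then σ (vertexVar u 0)
    else !σ (vertexVar u 1)) = true, by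
      intro u hu v hv _ huv
      have := h u v huv
      have := h v u huv.symm
      have := hχ u v huv
      simp only [Finset.coe_filter, Finset.mem_univ, true_and, Set.mem_ofPred_eq] at hu hv
      grind⟩
  let B : x.IndepSet := ⟨Finset.univ.filter fun u => (if σ (vertexVar u 2) then !σ (vertexVar u 1)
    else σ (vertexVar u 0)) = true, by
      intro u hu v hv _ huv
      have := h u v huv
      have := h v u huv.symm
      have := hχ u v huv
      simp only [Finset.coe_filter, Finset.mem_univ, true_and, Set.mem_ofPred_eq] at hu hv
      grind⟩
  refine ⟨A, B, ?_, ?_, hχ⟩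
  · rw [decoding_bitWord]
    simp only [encSol, A]
    congr 1
    funext u
    simp
  · rw [measure_impliesLocalized h, measure_impliesLocalized (feasible_combine A B hχ)]
    refine Finset.prod_congr rfl fun u _ => ?_
    have := hc u
    simp only [combine, assignment_vertexVar, Matrix.cons_val, A, B]
    cases h0 : σ (vertexVar u 0) <;> cases h1 : σ (vertexVar u 1) <;>
      cases h2 : σ (vertexVar u 2) <;> cases h3 : σ (vertexVar u 3) <;> simp_all

end WeightedGraph

theorem maxProdBIS_aptReduces : APTReduces maxProdBIS (maxProdCSPStar {constraintImplies}) := by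
  refine aptReduces_of_templates (P := maxProdBIS) (fun x => x.1) impliesVertexTemplate
    impliesEdgeTemplate (fun x => (impliesLocalized x.1).inst) (fun _ => rfl)
    (fun x => (impliesLocalized x.1).enc_inst) ?_
  rintro ⟨x, ⟨col⟩⟩ ε h0 h1 σ hσ
  change Fin (4 * x.numVertices) → Bool at σ
  have hα : (0 : ℝ) < 2 ^ ε := by positivity
  have hα4 : (2 : ℝ) ^ ε < 4 := by
    calc (2 : ℝ) ^ ε < 2 ^ (1 : ℝ) := Real.rpow_lt_rpow_of_exponent_lt (by norm_num) h1
      _ < 4 := by norm_num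
  have hle : ∀ τ, ((impliesLocalized x).inst.measure τ : ℝ) ≤
      2 ^ ε * (impliesLocalized x).inst.measure σ := fun τ => hσ.measure_le hα τ
  have hχ : ∀ u v, x.graph.Adj u v → decide (col u = 0) ≠ decide (col v = 0) := by
    intro u v huv
    have := col.valid huv
    simp only [ne_eq, decide_eq_decide]
    omega
  have hne : (impliesLocalized x).inst.measure σ ≠ 0 := by
    intro h
    -- Two empty sets with a given 2-colouring have as measure a product of tags, which is positive.
    -- The bipartition enters only here and in the recolouring argument, never in the program.
    have := hle (WeightedGraph.combine (fun u => decide (col u = 0)) ∅ ∅)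
    have hc := WeightedGraph.measure_combine (x := x) ⟨∅, by simp⟩ ⟨∅, by simp⟩ hχ
    rw [h, NNReal.coe_zero, mul_zero, ← NNReal.coe_zero, NNReal.coe_le_coe, nonpos_iff_eq_zero,
      hc] at this
    simp only [WeightedGraph.measure, Finset.prod_empty, one_mul] at this
    refine Finset.prod_ne_zero_iff.2 (fun u _ => ?_) this
    split_ifs <;> positivity
  obtain ⟨A, B, hA, hAB, hχ'⟩ := (WeightedGraph.feasible_of_measure_ne_zero hne).exists_eq_combine
    (WeightedGraph.ne_of_nearly_optimal hα4 hχ hne hle)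
  have : Finite (maxProdBIS.Sol ⟨x, ⟨col⟩⟩) := inferInstanceAs (Finite x.IndepSet)
  refine ⟨A, hA, MaxProblem.isApprox_of_measure_le (Real.one_le_rpow (by norm_num) h0.le) ?_⟩
  intro A'
  -- The competitor differs from the answer only in its first set; the measure of `B` and the tag
  -- factor are common to both and cancel, being nonzero.
  have hle' := hle (WeightedGraph.combine (fun u => σ (vertexVar u 2)) A'.1 B.1)
  rw [hAB] at hne hle'
  rw [WeightedGraph.measure_combine A B hχ'] at hne hle'
  rw [WeightedGraph.measure_combine A' B hχ', NNReal.coe_mul, NNReal.coe_mul (x.measure A),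
    ← mul_assoc] at hle'
  exact le_of_mul_le_mul_right hle'
    (NNReal.coe_pos.2 (pos_iff_ne_zero.2 (mul_ne_zero_iff.1 hne).2))

end

theorem mainTheorem9 :
    APTReduces maxProdIS (maxProdCSPStar {constraintOR}) ∧
      APTReduces maxProdBIS (maxProdCSPStar {constraintImplies}) := by
  exact ⟨maxProdIS_aptReduces, maxProdBIS_aptReduces⟩
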